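/- A real algebraic variety is an algebraic subset of some $\mathbb{R}^n$, up to isomorphism (every quasi-projective real algebraic variety is isomorphic to one); unless "Zariski" is specified, topological notions refer to the Euclidean topology. Let $X$, $Z$ be nonsingular real algebraic varieties and let $h\colon Z\to X$ be a regular map that is surjective and submersive. Put $V(h)_z=\ker\bigl(d_zh\colon T_zZ\to T_{h(z)}X\bigr)$ for $z\in Z$. A *spray* for $h$ is a triple $(E,p,s)$, where $p\colon E\to Z$ is an algebraic vector bundle (that is, up to isomorphism, an algebraic vector subbundle of a product bundle $Z\times\mathbb{R}^N$, with a frame of regular sections Zariski locally on $Z$) and $s\colon E\to Z$ is a regular map such that $s(E_z)\subseteq h^{-1}(h(z))$ and $s(0_z)=z$ for all $z\in Z$. It is *dominating* if $d_{0_z}s(E_z)=V(h)_z$ for all $z\in Z$, where $E_z=T_{0_z}E_z\subseteq T_{0_z}E$. Let $U\subseteq X$ be open. A *section* of $h$ over $U$ is a map $f\colon U\to Z$ with $h(f(x))=x$ for all $x\in U$; it is *regular* if it is the restriction of a section $\tilde U\to Z$ that is a regular map on some Zariski open set $\tilde U\subseteq X$ containing $U$. Two $C^\infty$ sections $f_0,f_1$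 over $U$ are *homotopic through $C^\infty$ sections* if there is a continuous map $F\colon U\times[0,1]\to Z$ such that $F_t=F(\cdot,t)$ is a $C^\infty$ section for every $t\in[0,1]$, $F_0=f_0$ and $F_1=f_1$. **Theorem 3.9.** Assume that $h\colon Z\to X$ admits a dominating spray. Let $U$ be an open subset of $X$ and let $f\colon U\to Z$ be a $C^\infty$ section of $h$ that is homotopic through $C^\infty$ sections to a regular section. Then $f$ can be approximated by regular sections in the $C^\infty$ topology: every neighborhood of $f$ in the space $C^\infty(U,Z)$ of $C^\infty$ maps, endowed with the weak $C^\infty$ topology (uniform convergence, in charts, of all derivatives on compact sets), contains a regular section $U\to Z$ of $h$. -/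

import Mathlib

namespace RealAlg

open scoped ContDiff

noncomputable section

/-! ### Real algebraic varieties

A (quasi-projective) real algebraic variety is isomorphic to an algebraic subset of some `ℝⁿ`;
varieties are represented by such subsets.  A coordinate space is `ι → ℝ` with `ι` finite; its
norm is used only through the topology and the differential calculus, which do not depend on the
choice of the norm. -/

/-- `X` is an algebraic subset of the coordinate space: the zero set of a family of polynomials. -/
def IsAlgebraicSet {ι : Type*} (X : Set (ι → ℝ)) : Prop :=
  ∃ T : Set (MvPolynomial ι ℝ), X = {x | ∀ P ∈ T, MvPolynomial.eval x P = 0}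

/-- `W` is a Zariski open subset of `X`. -/
def IsZariskiOpenIn {ι : Type*} (W X : Set (ι → ℝ)) : Prop :=
  ∃ T : Set (MvPolynomial ι ℝ), W = {x | x ∈ X ∧ ∃ P ∈ T, MvPolynomial.eval x P ≠ 0}

/-- `U` is an open subset of `X` in the Euclidean topology of `X`. -/
def IsOpenIn {ι : Type*} (U X : Set (ι → ℝ)) : Prop :=
  ∃ O : Set (ι → ℝ), IsOpen O ∧ U = X ∩ O

/-- The gradient of a polynomial at a point. -/
def polyGradient {ι : Type*} (P : MvPolynomial ι ℝ) (x : ι → ℝ) : ι → ℝ :=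
  fun i => MvPolynomial.eval x (MvPolynomial.pderiv i P)

/-- The point `x` of `X` is nonsingular: near `x` the set `X` is cut out by finitely many
polynomials that vanish on `X` and whose gradients at `x` are linearly independent.  (The local
dimension of `X`, the number of variables minus `c`, may depend on `x`.) -/
def IsNonsingularAt {ι : Type*} (X : Set (ι → ℝ)) (x : ι → ℝ) : Prop :=
  ∃ (c : ℕ) (P : Fin c → MvPolynomial ι ℝ),
    (∀ i, ∀ y ∈ X, MvPolynomial.eval y (P i) = 0) ∧
    LinearIndependent ℝ (fun i => polyGradient (P i) x) ∧
    ∀ᶠ y in nhds x, (∀ i, MvPolynomial.eval y (P i) = 0) → y ∈ X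

/-- A nonsingular real algebraic variety. -/
def IsNonsingularVariety {ι : Type*} (X : Set (ι → ℝ)) : Prop :=
  IsAlgebraicSet X ∧ ∀ x ∈ X, IsNonsingularAt X x

/-- A real function on a subset of a coordinate space is regular if it is, Zariski locally, a
quotient of two polynomials. -/
def IsRegularFun {ι : Type*} {S : Set (ι → ℝ)} (f : S → ℝ) : Prop :=
  ∀ x : S, ∃ P Q : MvPolynomial ι ℝ, MvPolynomial.eval (x : ι → ℝ) Q ≠ 0 ∧
    ∀ y : S, MvPolynomial.eval (y : ι → ℝ) Q ≠ 0 →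
      f y = MvPolynomial.eval (y : ι → ℝ) P / MvPolynomial.eval (y : ι → ℝ) Q

/-- A map is regular if its coordinates are regular functions. -/
def IsRegularMap {ι κ : Type*} {S : Set (ι → ℝ)} {T : Set (κ → ℝ)} (f : S → T) : Prop :=
  ∀ j, IsRegularFun (fun x => (f x : κ → ℝ) j)

/-! ### Tangent spaces and derivatives -/

/-- The tangent space `T_xX`: the vectors annihilated by the differentials at `x` of all
polynomials vanishing on `X`. -/
def tangentSpace {ι : Type*} [Fintype ι] (X : Set (ι → ℝ)) (x : ι → ℝ) :
    Submodule ℝ (ι → ℝ) where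
  carrier := {v | ∀ P : MvPolynomial ι ℝ, (∀ y ∈ X, MvPolynomial.eval y P = 0) →
    ∑ i, polyGradient P x i * v i = 0}
  zero_mem' := by intro P _; simp
  add_mem' := by
    intro v w hv hw P hP
    simp only [Pi.add_apply, mul_add, Finset.sum_add_distrib, hv P hP, hw P hP, add_zero]
  smul_mem' := by
    intro c v hv P hP
    have h : ∀ i, polyGradient P x i * (c • v) i = c * (polyGradient P x i * v i) := by
      intro i; simp only [Pi.smul_apply, smul_eq_mul]; ring
    simp only [h, ← Finset.mul_sum, hv P hP, mul_zero]

/-- The derivative at `x` of a map `f : S → T` between subsets of coordinate spaces, a linear map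
of the ambient spaces.  Only its values on vectors tangent to `S` at `x` are meaningful (there it
does not depend on any choice), and it is only applied to such vectors. -/
def differential {ι κ : Type*} [Fintype ι] [Fintype κ] {S : Set (ι → ℝ)} {T : Set (κ → ℝ)}
    (f : S → T) (x : ι → ℝ) : (ι → ℝ) →L[ℝ] (κ → ℝ) :=
  fderivWithin ℝ (Function.extend (Subtype.val : S → (ι → ℝ)) (fun y => (f y : κ → ℝ)) 0) S x

/-- `h : Z → X` is submersive: `d_z h` maps `T_zZ` onto `T_{h(z)}X` for every `z`. -/
def IsSubmersive {ι κ : Type*} [Fintype ι] [Fintype κ] {Z : Set (κ → ℝ)} {X : Set (ι → ℝ)}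
    (h : Z → X) : Prop :=
  ∀ z : Z, (tangentSpace Z z).map (differential h z).toLinearMap = tangentSpace X (h z)

/-- `V(h)_z`, the kernel of `d_z h : T_zZ → T_{h(z)}X`. -/
def verticalSpace {ι κ : Type*} [Fintype ι] [Fintype κ] {Z : Set (κ → ℝ)} {X : Set (ι → ℝ)}
    (h : Z → X) (z : Z) : Submodule ℝ (κ → ℝ) :=
  tangentSpace Z z ⊓ LinearMap.ker (differential h z).toLinearMap

/-! ### Algebraic vector bundles and sprays -/

/-- An algebraic vector bundle over `Z`.  By definition, an algebraic vector bundle is, up to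
isomorphism, an algebraic vector subbundle of a product bundle `Z × ℝᴺ`: a family of vector
subspaces of `ℝᴺ` which Zariski locally on `Z` has a frame of regular sections. -/
structure AlgVectorBundle {κ : Type*} (Z : Set (κ → ℝ)) where
  N : ℕ
  fiber : Z → Submodule ℝ (Fin N → ℝ)
  locally_trivial : ∀ z : Z, ∃ (W : Set (κ → ℝ)) (hW : W ⊆ Z) (r : ℕ)
    (e : Fin r → W → Fin N → ℝ),
    IsZariskiOpenIn W Z ∧ (z : κ → ℝ) ∈ W ∧
    (∀ i j, IsRegularFun (fun w => e i w j)) ∧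
    ∀ w : W, LinearIndependent ℝ (fun i => e i w) ∧
      Submodule.span ℝ (Set.range (fun i => e i w)) = fiber ⟨w, hW w.2⟩

namespace AlgVectorBundle

variable {κ : Type*} {Z : Set (κ → ℝ)} (E : AlgVectorBundle Z)

/-- The total space `{(z, v) : v ∈ E_z}`, a subset of `ℝ^κ × ℝᴺ`. -/
def total : Set (κ ⊕ Fin E.N → ℝ) :=
  {q | ∃ z : Z, ∃ v ∈ E.fiber z, q = Sum.elim (z : κ → ℝ) v}

/-- The vector `v ∈ E_z` as a point of the total space. -/
def point (z : Z) (v : E.fiber z) : E.total :=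
  ⟨Sum.elim (z : κ → ℝ) (v : Fin E.N → ℝ), z, v, v.2, rfl⟩

/-- The subspace `E_z = T_{0_z} E_z` of the tangent space to the total space at `0_z`: the vectors
`(0, v)` with `v ∈ E_z`. -/
def verticalTangent (z : Z) : Submodule ℝ (κ ⊕ Fin E.N → ℝ) where
  carrier := {q | ∃ v ∈ E.fiber z, q = Sum.elim (0 : κ → ℝ) v}
  zero_mem' := ⟨0, Submodule.zero_mem _, by ext i; cases i <;> rfl⟩
  add_mem' := by
    rintro _ _ ⟨v, hv, rfl⟩ ⟨w, hw, rfl⟩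
    exact ⟨v + w, Submodule.add_mem _ hv hw, by ext i; cases i <;> simp⟩
  smul_mem' := by
    rintro c _ ⟨v, hv, rfl⟩
    exact ⟨c • v, Submodule.smul_mem _ c hv, by ext i; cases i <;> simp⟩

end AlgVectorBundle

/-- `(E, p, s)` is a spray for `h : Z → X`, where `p : E → Z` is the bundle projection: `s` is
regular, `s(E_z) ⊆ h⁻¹(h(z))` and `s(0_z) = z`. -/
def IsSpray {ι κ : Type*} {Z : Set (κ → ℝ)} {X : Set (ι → ℝ)} (h : Z → X)
    (E : AlgVectorBundle Z) (s : E.total → Z) : Prop :=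
  IsRegularMap s ∧ (∀ (z : Z) (v : E.fiber z), h (s (E.point z v)) = h z) ∧
    ∀ z : Z, s (E.point z 0) = z

/-- The spray `(E, p, s)` is dominating: `d_{0_z} s (E_z) = V(h)_z` for all `z`. -/
def IsDominating {ι κ : Type*} [Fintype ι] [Fintype κ] {Z : Set (κ → ℝ)} {X : Set (ι → ℝ)}
    (h : Z → X) (E : AlgVectorBundle Z) (s : E.total → Z) : Prop :=
  ∀ z : Z, (E.verticalTangent z).map (differential s (E.point z 0)).toLinearMap =
    verticalSpace h z

/-- `h : Z → X` is malleable: it admits a dominating spray. -/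
def IsMalleable {ι κ : Type*} [Fintype ι] [Fintype κ] {Z : Set (κ → ℝ)} {X : Set (ι → ℝ)}
    (h : Z → X) : Prop :=
  ∃ (E : AlgVectorBundle Z) (s : E.total → Z), IsSpray h E s ∧ IsDominating h E s

/-! ### Smooth maps and the `C^∞` topology -/

/-- A map on a subset of a coordinate space is `C^∞` if near each point it is the restriction of
a map of the ambient space that is `C^∞` at that point. -/
def IsSmooth {ι κ : Type*} [Fintype ι] [Fintype κ] {M : Set (ι → ℝ)} (f : M → κ → ℝ) : Prop :=
  ∀ x : M, ∃ F : (ι → ℝ) → (κ → ℝ), ContDiffAt ℝ ∞ F x ∧ ∀ᶠ y : M in nhds x, F y = f y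

/-- The `C^∞` charts of a submanifold `M` of a coordinate space: diffeomorphisms of open subsets
of `M` onto open subsets of `ℝᵈ`. -/
def IsSmoothChart {ι : Type*} [Fintype ι] {M : Set (ι → ℝ)} {d : ℕ}
    (φ : OpenPartialHomeomorph M (Fin d → ℝ)) : Prop :=
  (∀ x ∈ φ.source, ∃ F : (ι → ℝ) → (Fin d → ℝ),
    ContDiffAt ℝ ∞ F x ∧ ∀ᶠ y : M in nhds x, F y = φ y) ∧
  ContDiffOn ℝ ∞ (fun y => (φ.symm y : ι → ℝ)) φ.target

/-- The set `C^∞(M, N)`. -/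
structure SmoothMap {ι κ : Type*} [Fintype ι] [Fintype κ]
    (M : Set (ι → ℝ)) (N : Set (κ → ℝ)) where
  toFun : M → N
  smooth : IsSmooth (fun x => (toFun x : κ → ℝ))

/-- The maps `g` with `g(K) ⊆ dom ψ` whose expression `ψ ∘ g ∘ φ⁻¹` in the charts `φ`, `ψ` is
`ε`-close on `φ(K)` to that of `f`, together with the derivatives of order at most `r`. -/
def SmoothMap.subbasicNhd {ι κ : Type*} [Fintype ι] [Fintype κ]
    {M : Set (ι → ℝ)} {N : Set (κ → ℝ)} (f : SmoothMap M N) {d e : ℕ}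
    (φ : OpenPartialHomeomorph M (Fin d → ℝ)) (ψ : OpenPartialHomeomorph N (Fin e → ℝ))
    (K : Set M) (r : ℕ) (ε : ℝ) : Set (SmoothMap M N) :=
  {g | (∀ x ∈ K, g.toFun x ∈ ψ.source) ∧ ∀ x ∈ K, ∀ k ≤ r,
    ‖iteratedFDeriv ℝ k (fun y => ψ (f.toFun (φ.symm y))) (φ x) -
      iteratedFDeriv ℝ k (fun y => ψ (g.toFun (φ.symm y))) (φ x)‖ < ε}

/-- The (weak) `C^∞` topology on `C^∞(M, N)`. -/
instance SmoothMap.instTopologicalSpace {ι κ : Type*} [Fintype ι] [Fintype κ]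
    {M : Set (ι → ℝ)} {N : Set (κ → ℝ)} : TopologicalSpace (SmoothMap M N) :=
  TopologicalSpace.generateFrom
    {𝒮 | ∃ (f : SmoothMap M N) (d e : ℕ) (φ : OpenPartialHomeomorph M (Fin d → ℝ))
      (ψ : OpenPartialHomeomorph N (Fin e → ℝ)) (K : Set M) (r : ℕ) (ε : ℝ),
      IsSmoothChart φ ∧ IsSmoothChart ψ ∧ IsCompact K ∧ K ⊆ φ.source ∧
      (∀ x ∈ K, f.toFun x ∈ ψ.source) ∧ 0 < ε ∧ 𝒮 = f.subbasicNhd φ ψ K r ε}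

/-! ### Sections -/

/-- `f : U → Z` is a section of `h : Z → X` over `U ⊆ X`. -/
def IsSection {ι κ : Type*} {Z : Set (κ → ℝ)} {X U : Set (ι → ℝ)}
    (h : Z → X) (f : U → Z) : Prop :=
  ∀ x : U, (h (f x) : ι → ℝ) = x

/-- `g : U → Z` is a regular section: it is the restriction of a section that is a regular map on
a Zariski open subset of `X` containing `U`. -/
def IsRegularSection {ι κ : Type*} {Z : Set (κ → ℝ)} {X U : Set (ι → ℝ)}
    (h : Z → X) (g : U → Z) : Prop :=
  ∃ (W : Set (ι → ℝ)) (hUW : U ⊆ W) (g' : W → Z), IsZariskiOpenIn W X ∧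
    IsSection h g' ∧ IsRegularMap g' ∧ ∀ x : U, g' ⟨x, hUW x.2⟩ = g x

/-- `f₀` and `f₁` are homotopic through `C^∞` sections of `h` over `U`. -/
def HomotopicThroughSmoothSections {ι κ : Type*} [Fintype ι] [Fintype κ]
    {Z : Set (κ → ℝ)} {X U : Set (ι → ℝ)} (h : Z → X) (f₀ f₁ : U → Z) : Prop :=
  ∃ F : U × unitInterval → Z, Continuous F ∧
    (∀ t, IsSmooth (fun x => (F (x, t) : κ → ℝ)) ∧ IsSection h (fun x => F (x, t))) ∧
    (∀ x, F (x, 0) = f₀ x) ∧ ∀ x, F (x, 1) = f₁ x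

end

end RealAlg

/-! Call a section `c` approximable (to order `m`, near a compact `K`) if it is the member at `ε =
0` of a family `g ε` that consists of regular sections for `ε ≠ 0` and whose derivatives of order at
most `m` converge near `K`. Regular sections are approximable.

Two facts carry the proof. By `IsApproximable.spray`, if `S : Z × ℝʳ → Z` is a spray on a product
bundle and `w : U → ℝʳ` is `C^m`, then `S(c, w)` is approximable along with `c`: near `K`, `w` is a
limit of polynomial maps `q ε`, and `S(g ε, q ε)` is a regular section. By
`exists_trivialSpray_connecting`, a dominating spray gives near each point of `Z` such an `S`
together with a smooth `θ`, zero on the diagonal, such that `S(z, θ(z, z')) = z'` for nearby points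
of the same fibre; this is the implicit function theorem.

Hence, if sections `c` and `d` are close, `S(c, χ θ(c, d))` with a bump function `χ` is approximable
when `c` is, and equals `d` where `χ = 1`. Finitely many such corrections turn `c` into `d` near
`K`. The corrections are exact, so closeness in the `C⁰` sense suffices, and a continuous homotopy
provides it: the times at which the homotopy is approximable form a clopen subset of `[0, 1]`. A
neighbourhood in the weak topology tests only finitely many compact sets and orders, so a single
pair `m`, `K` is enough at the end. -/

namespace RealAlg

open Filter Topology Set
open scoped ContDiff

set_option linter.unusedSectionVars false

/-! ### Joint continuity of derivatives in families -/

section Jets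

variable {T : Type} [TopologicalSpace T]
  {E F G : Type} [NormedAddCommGroup E] [NormedSpace ℝ E]
  [NormedAddCommGroup F] [NormedSpace ℝ F] [NormedAddCommGroup G] [NormedSpace ℝ G]

/-- The family `u t`, `t ∈ T`, of maps is `C^m` near `x` for `t` near `τ`, and its derivatives of
order at most `m` are jointly continuous at `(τ, x)`. -/
def JetContinuousAt (m : ℕ) (u : T → E → F) (τ : T) (x : E) : Prop :=
  (∀ᶠ p : T × E in 𝓝 (τ, x), ContDiffAt ℝ m (u p.1) p.2) ∧
    ∀ j ≤ m, ContinuousAt (fun p : T × E => iteratedFDeriv ℝ j (u p.1) p.2) (τ, x)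

variable {m : ℕ} {u v : T → E → F} {τ : T} {x : E}

/-- Derivatives of `u t` at `y` depend on the germ of the slice `u t`; this supplies statements
about such germs. -/
theorem eventually_eventually_slice {P : T × E → Prop} (h : ∀ᶠ p in 𝓝 (τ, x), P p) :
    ∀ᶠ p in 𝓝 (τ, x), ∀ᶠ y in 𝓝 p.2, P (p.1, y) := by
  filter_upwards [eventually_eventually_nhds.2 h] with p hp
  exact (Continuous.tendsto (by fun_prop : Continuous fun y : E => (p.1, y)) p.2).eventually hp

theorem JetContinuousAt.continuousAt (h : JetContinuousAt m u τ x) :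
    ContinuousAt (fun p : T × E => u p.1 p.2) (τ, x) := by
  have h0 := h.2 0 (Nat.zero_le _)
  have := (continuousMultilinearCurryFin0 ℝ E F).continuous.continuousAt.comp h0
  refine this.congr (Eventually.of_forall fun p => ?_)
  simp

theorem JetContinuousAt.congr (h : JetContinuousAt m u τ x)
    (huv : ∀ᶠ p : T × E in 𝓝 (τ, x), u p.1 p.2 = v p.1 p.2) : JetContinuousAt m v τ x := by
  have huv' : ∀ᶠ p : T × E in 𝓝 (τ, x), u p.1 =ᶠ[𝓝 p.2] v p.1 := eventually_eventually_slice huv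
  refine ⟨?_, fun j hj => (h.2 j hj).congr ?_⟩
  · filter_upwards [h.1, huv'] with p hp hpe using hp.congr_of_eventuallyEq hpe.symm
  · filter_upwards [huv'] with p hpe using (hpe.iteratedFDeriv ℝ j).eq_of_nhds

theorem jetContinuousAt_zero :
    JetContinuousAt 0 u τ x ↔ (∀ᶠ p : T × E in 𝓝 (τ, x), ContDiffAt ℝ 0 (u p.1) p.2) ∧
      ContinuousAt (fun p : T × E => u p.1 p.2) (τ, x) := by
  refine ⟨fun h => ⟨h.1, h.continuousAt⟩, fun h => ⟨h.1, fun j hj => ?_⟩⟩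
  obtain rfl : j = 0 := by omega
  refine ((continuousMultilinearCurryFin0 ℝ E F).symm.continuous.continuousAt.comp h.2).congr
    (Eventually.of_forall fun p => ?_)
  ext; simp

/-- Peeling off one derivative lets the closure properties below be proved by induction on the
order, with only the first-order chain rule. -/
theorem jetContinuousAt_succ :
    JetContinuousAt (m + 1) u τ x ↔
      ((∀ᶠ p : T × E in 𝓝 (τ, x), DifferentiableAt ℝ (u p.1) p.2) ∧
      ContinuousAt (fun p : T × E => u p.1 p.2) (τ, x)) ∧
      JetContinuousAt m (fun t => fderiv ℝ (u t)) τ x := by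
  constructor
  · intro h
    refine ⟨⟨?_, h.continuousAt⟩, ?_, fun j hj => ?_⟩
    · filter_upwards [h.1] with p hp using hp.differentiableAt (by simp)
    · filter_upwards [h.1] with p hp
      exact hp.fderiv_right (m := m) (by norm_cast)
    · refine ((continuousMultilinearCurryRightEquiv' ℝ j E F).continuous.continuousAt.comp
        (h.2 (j + 1) (by omega))).congr (Eventually.of_forall fun p => ?_)
      simp [iteratedFDeriv_succ_eq_comp_right]
  · rintro ⟨⟨hd, hc⟩, hs, hj⟩
    refine ⟨?_, fun j hjm => ?_⟩
    · filter_upwards [hs, eventually_eventually_slice hd] with p hp hd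
      have := (contDiffAt_succ_iff_hasFDerivAt (𝕜 := ℝ) (n := m) (f := u p.1) (x := p.2)).2
        ⟨fderiv ℝ (u p.1), ⟨_, hd, fun y hy => DifferentiableAt.hasFDerivAt hy⟩, hp⟩
      exact_mod_cast this
    · rcases j with _ | j
      · refine ((continuousMultilinearCurryFin0 ℝ E F).symm.continuous.continuousAt.comp hc).congr
          (Eventually.of_forall fun p => ?_)
        ext; simp
      · refine ((continuousMultilinearCurryRightEquiv' ℝ j E F).symm.continuous.continuousAt.comp
          (hj j (by omega))).congr (Eventually.of_forall fun p => ?_)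
        simp [iteratedFDeriv_succ_eq_comp_right]

theorem JetContinuousAt.of_le {n : ℕ} (h : JetContinuousAt m u τ x) (hn : n ≤ m) :
    JetContinuousAt n u τ x :=
  ⟨h.1.mono fun _ hp => hp.of_le (by exact_mod_cast hn), fun j hj => h.2 j (hj.trans hn)⟩

theorem jetContinuousAt_const {f : E → F} (hf : ContDiffAt ℝ m f x) :
    JetContinuousAt m (fun _ : T => f) τ x := by
  refine ⟨?_, fun j hj => ?_⟩
  · exact (continuous_snd.tendsto (τ, x)).eventually (hf.eventually (by simp))
  · exact (hf.continuousAt_iteratedFDeriv (by exact_mod_cast hj)).comp_of_eq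
      continuousAt_snd rfl

theorem JetContinuousAt.clm_comp (L : F →L[ℝ] G) (h : JetContinuousAt m u τ x) :
    JetContinuousAt m (fun t y => L (u t y)) τ x := by
  induction m generalizing F G with
  | zero =>
    rw [jetContinuousAt_zero] at h ⊢
    exact ⟨h.1.mono fun p hp => L.contDiff.contDiffAt.comp p.2 hp,
      L.continuous.continuousAt.comp h.2⟩
  | succ m ih =>
    rw [jetContinuousAt_succ] at h ⊢
    refine ⟨⟨h.1.1.mono fun p hp => L.differentiableAt.comp p.2 hp,
      L.continuous.continuousAt.comp h.1.2⟩, ?_⟩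
    refine (ih (ContinuousLinearMap.compL ℝ E F G L) h.2).congr ?_
    filter_upwards [h.1.1] with p hp
    exact (L.hasFDerivAt.comp p.2 hp.hasFDerivAt).fderiv.symm

theorem JetContinuousAt.prodMk {w : T → E → G} (h : JetContinuousAt m u τ x)
    (h' : JetContinuousAt m w τ x) : JetContinuousAt m (fun t y => (u t y, w t y)) τ x := by
  induction m generalizing F G with
  | zero =>
    rw [jetContinuousAt_zero] at h h' ⊢
    exact ⟨by filter_upwards [h.1, h'.1] with p hp hp' using hp.prodMk hp', h.2.prodMk h'.2⟩
  | succ m ih =>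
    rw [jetContinuousAt_succ] at h h' ⊢
    refine ⟨⟨by filter_upwards [h.1.1, h'.1.1] with p hp hp' using hp.prodMk hp',
      h.1.2.prodMk h'.1.2⟩, ?_⟩
    refine ((ih h.2 h'.2).clm_comp
      ((ContinuousLinearMap.compL ℝ E F (F × G) (.inl ℝ F G)).coprod
        (ContinuousLinearMap.compL ℝ E G (F × G) (.inr ℝ F G)))).congr ?_
    filter_upwards [h.1.1, h'.1.1] with p hp hp'
    rw [(hp.hasFDerivAt.prodMk hp'.hasFDerivAt).fderiv]
    ext e <;> simp

/-- The derivative of the composite is the bilinear composition of `fderiv (g t)` along `u t` with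
`fderiv (u t)`. The induction hypothesis is used twice: for the first factor, and for composing the
pair with the smooth bilinear map. -/
theorem JetContinuousAt.comp {g : T → F → G} (hg : JetContinuousAt m g τ (u τ x))
    (h : JetContinuousAt m u τ x) : JetContinuousAt m (fun t y => g t (u t y)) τ x := by
  induction m generalizing E F G with
  | zero =>
    have hc : ContinuousAt (fun p : T × E => (p.1, u p.1 p.2)) (τ, x) :=
      continuousAt_fst.prodMk h.continuousAt
    rw [jetContinuousAt_zero] at hg h ⊢
    refine ⟨?_, ContinuousAt.comp (f := fun p : T × E => (p.1, u p.1 p.2))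
      (g := fun p : T × F => g p.1 p.2) hg.2 hc⟩
    filter_upwards [h.1, hc.eventually hg.1] with p hp hp'
    exact ContDiffAt.comp p.2 hp' hp
  | succ m ih =>
    have hc : ContinuousAt (fun p : T × E => (p.1, u p.1 p.2)) (τ, x) :=
      continuousAt_fst.prodMk h.continuousAt
    have h' := h.of_le (Nat.le_succ m)
    rw [jetContinuousAt_succ] at hg h ⊢
    refine ⟨⟨?_, ContinuousAt.comp (f := fun p : T × E => (p.1, u p.1 p.2))
      (g := fun p : T × F => g p.1 p.2) hg.1.2 hc⟩, ?_⟩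
    · filter_upwards [h.1.1, hc.eventually hg.1.1] with p hp hp'
      exact DifferentiableAt.comp p.2 hp' hp
    · have hpair := (ih hg.2 h').prodMk h.2
      have hB : ContDiff ℝ m (fun q : (F →L[ℝ] G) × (E →L[ℝ] F) => q.1.comp q.2) :=
        contDiff_fst.clm_comp contDiff_snd
      refine (ih (g := fun _ q => q.1.comp q.2)
        (jetContinuousAt_const hB.contDiffAt) hpair).congr ?_
      filter_upwards [h.1.1, hc.eventually hg.1.1] with p hp hp'
      exact (hp'.hasFDerivAt.comp p.2 hp.hasFDerivAt).fderiv.symm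

end Jets

/-! ### Weierstrass approximation with derivatives -/

section Weierstrass

open MeasureTheory ContinuousLinearMap
open scoped Convolution

variable {a : ℕ}

theorem exists_mvPolynomial_near_of_isCompact {f : (Fin a → ℝ) → ℝ} (hf : Continuous f)
    {K : Set (Fin a → ℝ)} (hK : IsCompact K) {ε : ℝ} (hε : 0 < ε) :
    ∃ P : MvPolynomial (Fin a) ℝ, ∀ x ∈ K, ‖MvPolynomial.eval x P - f x‖ < ε := by
  let X : Fin a → C(Fin a → ℝ, ℝ) := fun i => ⟨fun x => x i, continuous_apply i⟩
  have hA : (MvPolynomial.aeval (R := ℝ) X).range.SeparatesPoints := by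
    intro x y hxy
    obtain ⟨i, hi⟩ := Function.ne_iff.1 hxy
    exact ⟨_, ⟨X i, ⟨MvPolynomial.X i, by simp⟩, rfl⟩, hi⟩
  obtain ⟨g, ⟨P, rfl⟩, hg⟩ :=
    ContinuousMap.exists_mem_subalgebra_near_continuous_of_isCompact_of_separatesPoints hA
      ⟨f, hf⟩ hK hε
  refine ⟨P, fun x hx => ?_⟩
  have key : ∀ P : MvPolynomial (Fin a) ℝ,
      (MvPolynomial.aeval (R := ℝ) X P) x = MvPolynomial.eval x P := by
    intro P
    induction P using MvPolynomial.induction_on with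
    | C r => simp
    | add p q hp hq => simp [hp, hq]
    | mul_X p i hp => simp [hp, X]
  simpa [key] using hg x hx

/-- Induction on `ρ` for all `f` at once: a factor `xᵢ - tᵢ` gives `xᵢ` times the integral for `f`,
minus the integral for `tᵢ f`. -/
theorem exists_mvPolynomial_eq_convolution (ρ : MvPolynomial (Fin a) ℝ) {f : (Fin a → ℝ) → ℝ}
    (hf : Continuous f) (hfc : HasCompactSupport f) :
    ∃ Q : MvPolynomial (Fin a) ℝ, ∀ x,
      ∫ t, MvPolynomial.eval (x - t) ρ * f t = MvPolynomial.eval x Q := by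
  have hint : ∀ (P : MvPolynomial (Fin a) ℝ) (g : (Fin a → ℝ) → ℝ), Continuous g →
      HasCompactSupport g → ∀ x, Integrable (fun t => MvPolynomial.eval (x - t) P * g t) := by
    intro P g hg hgc x
    refine Continuous.integrable_of_hasCompactSupport ?_ hgc.mul_left
    exact ((MvPolynomial.continuous_eval P).comp (by fun_prop)).mul hg
  induction ρ using MvPolynomial.induction_on generalizing f with
  | C r => exact ⟨MvPolynomial.C (∫ t, r * f t), fun x => by simp⟩
  | add p q hp hq =>
    obtain ⟨P, hP⟩ := hp hf hfc
    obtain ⟨Q, hQ⟩ := hq hf hfc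
    refine ⟨P + Q, fun x => ?_⟩
    simp only [map_add, add_mul]
    rw [integral_add (hint p f hf hfc x) (hint q f hf hfc x), hP, hQ]
  | mul_X p i hp =>
    obtain ⟨P, hP⟩ := hp hf hfc
    have hg : Continuous fun t : Fin a → ℝ => t i * f t := (continuous_apply i).mul hf
    have hgc : HasCompactSupport fun t : Fin a → ℝ => t i * f t := hfc.mul_left
    obtain ⟨Q, hQ⟩ := hp hg hgc
    refine ⟨MvPolynomial.X i * P - Q, fun x => ?_⟩
    simp only [map_sub, map_mul, MvPolynomial.eval_X, ← hP, ← hQ]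
    rw [← integral_const_mul, ← integral_sub ((hint p f hf hfc x).const_mul _) (hint p _ hg hgc x)]
    congr 1; ext t; simp only [Pi.sub_apply]; ring

/-- Polynomial substitutes for mollifiers. As `ε → 0` the error tends to zero while the balls of
radius `|ε|⁻¹` exhaust the space; absolute values let `ε` range over a full punctured neighbourhood
of `0`. -/
theorem exists_mvPolynomial_near_normed_bump (a : ℕ) :
    ∃ (ρ : ℝ → MvPolynomial (Fin a) ℝ) (φ : ℝ → ContDiffBump (0 : Fin a → ℝ)),
      ∀ ε ≠ 0, (φ ε).rOut = |ε| ∧ ∀ x ∈ Metric.closedBall (0 : Fin a → ℝ) |ε|⁻¹,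
        ‖MvPolynomial.eval x (ρ ε) - (φ ε).normed volume x‖ < |ε| := by
  have : ∀ ε : ℝ, ∃ (ρ : MvPolynomial (Fin a) ℝ) (φ : ContDiffBump (0 : Fin a → ℝ)),
      ε ≠ 0 → φ.rOut = |ε| ∧ ∀ x ∈ Metric.closedBall (0 : Fin a → ℝ) |ε|⁻¹,
        ‖MvPolynomial.eval x ρ - φ.normed volume x‖ < |ε| := by
    intro ε
    by_cases hε : ε = 0
    · exact ⟨0, default, fun h => absurd hε h⟩
    · have h := abs_pos.2 hε
      let φ : ContDiffBump (0 : Fin a → ℝ) := ⟨|ε| / 2, |ε|, by positivity, by linarith⟩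
      obtain ⟨ρ, hρ⟩ := exists_mvPolynomial_near_of_isCompact (φ.continuous_normed (μ := volume))
        (isCompact_closedBall (0 : Fin a → ℝ) |ε|⁻¹) h
      exact ⟨ρ, φ, fun _ => ⟨rfl, hρ⟩⟩
  choose ρ φ h using this
  exact ⟨ρ, φ, h⟩

variable {ρ : ℝ → MvPolynomial (Fin a) ℝ} {φ : ℝ → ContDiffBump (0 : Fin a → ℝ)}
  {F : Type} [NormedAddCommGroup F] [NormedSpace ℝ F]

theorem continuous_eval_smul_comp_sub (P : MvPolynomial (Fin a) ℝ) {f : (Fin a → ℝ) → F}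
    (hf : Continuous f) (x : Fin a → ℝ) :
    Continuous fun t => MvPolynomial.eval t P • f (x - t) :=
  (MvPolynomial.continuous_eval P).smul (hf.comp (by fun_prop))

theorem hasCompactSupport_comp_const_sub {f : (Fin a → ℝ) → F}
    (hf : HasCompactSupport f) (x : Fin a → ℝ) : HasCompactSupport fun t => f (x - t) :=
  hf.comp_homeomorph (Homeomorph.subLeft x)

/-- Convolution with the bumps converges, and replacing a bump by its polynomial costs at most `|ε|
∫ ‖f‖`: since `f` has compact support, only `t` in a fixed ball contribute, and for small `ε` this
ball lies within radius `|ε|⁻¹`. -/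
theorem tendsto_convolution_mvPolynomial [CompleteSpace F]
    (hρ : ∀ ε ≠ 0, (φ ε).rOut = |ε| ∧ ∀ x ∈ Metric.closedBall (0 : Fin a → ℝ) |ε|⁻¹,
        ‖MvPolynomial.eval x (ρ ε) - (φ ε).normed volume x‖ < |ε|)
    {f : (Fin a → ℝ) → F} (hf : Continuous f) (hfc : HasCompactSupport f) (x : Fin a → ℝ) :
    Tendsto (fun p : ℝ × (Fin a → ℝ) =>
      ((fun t => MvPolynomial.eval t (ρ p.1)) ⋆[lsmul ℝ ℝ, volume] f) p.2)
      (𝓝[≠] 0 ×ˢ 𝓝 x) (𝓝 (f x)) := by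
  have hne : ∀ᶠ p : ℝ × (Fin a → ℝ) in 𝓝[≠] 0 ×ˢ 𝓝 x, p.1 ≠ 0 :=
    tendsto_fst.eventually (eventually_mem_nhdsWithin)
  have h0 : Tendsto (fun p : ℝ × (Fin a → ℝ) => |p.1|) (𝓝[≠] 0 ×ˢ 𝓝 x) (𝓝 0) := by
    have : Tendsto (fun e : ℝ => |e|) (𝓝[≠] 0) (𝓝 0) := by
      simpa using (continuous_abs.tendsto (0 : ℝ)).mono_left nhdsWithin_le_nhds
    exact this.comp tendsto_fst
  have h1 : Tendsto (fun p : ℝ × (Fin a → ℝ) =>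
      ((φ p.1).normed volume ⋆[lsmul ℝ ℝ, volume] f) p.2) (𝓝[≠] 0 ×ˢ 𝓝 x) (𝓝 (f x)) := by
    refine ContDiffBump.convolution_tendsto_right (x₀ := x) (k := fun p : ℝ × (Fin a → ℝ) => p.2)
      (g := fun _ => f) ?_ ?_ ?_ tendsto_snd
    · refine h0.congr' ?_
      filter_upwards [hne] with p hp using (hρ _ hp).1.symm
    · exact Eventually.of_forall fun _ => hf.aestronglyMeasurable
    · exact (hf.tendsto x).comp tendsto_snd
  obtain ⟨R, hR⟩ := hfc.isCompact.isBounded.subset_closedBall (0 : Fin a → ℝ)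
  have hfi : Integrable fun t => ‖f t‖ :=
    (hf.integrable_of_hasCompactSupport hfc).norm
  have hinv : ∀ᶠ p : ℝ × (Fin a → ℝ) in 𝓝[≠] 0 ×ˢ 𝓝 x, ‖x‖ + 1 + R ≤ |p.1|⁻¹ := by
    have : Tendsto (fun e : ℝ => |e|⁻¹) (𝓝[≠] 0) atTop := by
      exact tendsto_inv_nhdsGT_zero.comp (tendsto_abs_nhdsNE_zero (G := ℝ))
    exact (this.comp tendsto_fst).eventually (eventually_ge_atTop _)
  have hball : ∀ᶠ p : ℝ × (Fin a → ℝ) in 𝓝[≠] 0 ×ˢ 𝓝 x, ‖p.2‖ ≤ ‖x‖ + 1 :=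
    tendsto_snd.eventually ((continuous_norm.tendsto x).eventually
      (eventually_le_nhds (by linarith)))
  have h2 : Tendsto (fun p : ℝ × (Fin a → ℝ) =>
      ((fun t => MvPolynomial.eval t (ρ p.1)) ⋆[lsmul ℝ ℝ, volume] f) p.2 -
      ((φ p.1).normed volume ⋆[lsmul ℝ ℝ, volume] f) p.2) (𝓝[≠] 0 ×ˢ 𝓝 x) (𝓝 0) := by
    refine squeeze_zero_norm' (a := fun p => |p.1| * ∫ t, ‖f t‖) ?_ (by simpa using h0.mul_const _)
    filter_upwards [hne, hinv, hball] with p hp hpi hpb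
    have hc1 := continuous_eval_smul_comp_sub (ρ p.1) hf p.2
    have hs := hasCompactSupport_comp_const_sub hfc p.2
    have hc2 : Continuous fun t => (φ p.1).normed volume t • f (p.2 - t) :=
      ((φ p.1).continuous_normed).smul (hf.comp (by fun_prop))
    rw [convolution_def, convolution_def]
    simp only [lsmul_apply]
    rw [← integral_sub (hc1.integrable_of_hasCompactSupport hs.smul_left)
      (hc2.integrable_of_hasCompactSupport hs.smul_left),
      ← integral_sub_left_eq_self (fun t => ‖f t‖) volume p.2, ← integral_const_mul]
    refine norm_integral_le_of_norm_le ((hfi.comp_sub_left p.2).const_mul _)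
      (Eventually.of_forall fun t => ?_)
    rw [← sub_smul, norm_smul]
    by_cases ht : f (p.2 - t) = 0
    · simp [ht]
    · refine mul_le_mul_of_nonneg_right (((hρ _ hp).2 t ?_).le) (norm_nonneg _)
      have h3 := hR (subset_tsupport f ht)
      rw [mem_closedBall_zero_iff] at h3 ⊢
      calc ‖t‖ = ‖p.2 - (p.2 - t)‖ := by simp
        _ ≤ ‖p.2‖ + ‖p.2 - t‖ := norm_sub_le _ _
        _ ≤ |p.1|⁻¹ := by linarith
  simpa using h2.add h1

open Classical in
theorem continuousAt_convolution_mvPolynomial [CompleteSpace F]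
    (hρ : ∀ ε ≠ 0, (φ ε).rOut = |ε| ∧ ∀ x ∈ Metric.closedBall (0 : Fin a → ℝ) |ε|⁻¹,
        ‖MvPolynomial.eval x (ρ ε) - (φ ε).normed volume x‖ < |ε|)
    {f : (Fin a → ℝ) → F} (hf : Continuous f) (hfc : HasCompactSupport f) (x : Fin a → ℝ) :
    ContinuousAt (fun p : ℝ × (Fin a → ℝ) => (if p.1 = 0 then f else
      (fun t => MvPolynomial.eval t (ρ p.1)) ⋆[lsmul ℝ ℝ, volume] f) p.2) (0, x) := by
  rw [ContinuousAt, nhds_prod_eq, ← pure_sup_nhdsNE (0 : ℝ), sup_prod]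
  simp only [if_true]
  refine Tendsto.sup ?_ ?_
  · rw [pure_prod, tendsto_map'_iff]
    simpa [Function.comp_def] using hf.tendsto x
  · refine (tendsto_convolution_mvPolynomial hρ hf hfc x).congr' ?_
    have hne : ∀ᶠ p : ℝ × (Fin a → ℝ) in 𝓝[≠] 0 ×ˢ 𝓝 x, p.1 ≠ 0 :=
      tendsto_fst.eventually (eventually_mem_nhdsWithin)
    filter_upwards [hne] with p hp
    simp [hp]

-- Differentiating the convolution moves the derivative onto `f`, so the induction passes from `f`
-- to `fderiv ℝ f`; this is why the target space is generalized.
open Classical in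
theorem jetContinuousAt_convolution_mvPolynomial [CompleteSpace F]
    (hρ : ∀ ε ≠ 0, (φ ε).rOut = |ε| ∧ ∀ x ∈ Metric.closedBall (0 : Fin a → ℝ) |ε|⁻¹,
        ‖MvPolynomial.eval x (ρ ε) - (φ ε).normed volume x‖ < |ε|) {m : ℕ}
    {f : (Fin a → ℝ) → F} (hf : ContDiff ℝ m f) (hfc : HasCompactSupport f) (x : Fin a → ℝ) :
    JetContinuousAt m (fun ε : ℝ => if ε = 0 then f else
      (fun t => MvPolynomial.eval t (ρ ε)) ⋆[lsmul ℝ ℝ, volume] f) 0 x := by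
  have hloc : ∀ P : MvPolynomial (Fin a) ℝ,
      LocallyIntegrable (fun t => MvPolynomial.eval t P) volume :=
    fun P => (MvPolynomial.continuous_eval P).locallyIntegrable
  induction m generalizing F with
  | zero =>
    rw [jetContinuousAt_zero]
    refine ⟨Eventually.of_forall fun p => ?_,
      continuousAt_convolution_mvPolynomial hρ hf.continuous hfc x⟩
    split_ifs
    · exact hf.contDiffAt
    · exact (hfc.contDiff_convolution_right (n := 0) _ (hloc _) hf).contDiffAt
  | succ m ih =>
    have hf1 : ContDiff ℝ 1 f := hf.of_le (by norm_cast; omega)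
    have hf' : ContDiff ℝ m (fderiv ℝ f) := hf.fderiv_right (by norm_cast)
    have hd : ∀ P : MvPolynomial (Fin a) ℝ, ∀ y, HasFDerivAt
        ((fun t => MvPolynomial.eval t P) ⋆[lsmul ℝ ℝ, volume] f)
        (((fun t => MvPolynomial.eval t P) ⋆[lsmul ℝ ℝ, volume] (fderiv ℝ f)) y) y := by
      intro P y
      have h := hfc.hasFDerivAt_convolution_right (lsmul ℝ ℝ) (hloc P) hf1 y
      have hL : precompR (Fin a → ℝ) (lsmul ℝ ℝ : ℝ →L[ℝ] F →L[ℝ] F) = lsmul ℝ ℝ := by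
        ext r A
        simp [precompR]
      rwa [hL] at h
    have hfc' := hfc.fderiv ℝ
    rw [jetContinuousAt_succ]
    refine ⟨⟨Eventually.of_forall fun p => ?_,
      continuousAt_convolution_mvPolynomial hρ hf.continuous hfc x⟩, ?_⟩
    · split_ifs
      · exact (hf1.differentiable (by simp)).differentiableAt
      · exact (hd _ _).differentiableAt
    · refine (ih hf' hfc').congr (Eventually.of_forall fun p => ?_)
      split_ifs
      · rfl
      · exact (hd _ _).fderiv.symm

/-- Weierstrass approximation in the `C^m` topology: a compactly supported `C^m` map is a limit of
polynomial maps. -/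
theorem exists_polynomial_jetContinuousAt {m r : ℕ} {f : (Fin a → ℝ) → Fin r → ℝ}
    (hf : ContDiff ℝ m f) (hfc : HasCompactSupport f) :
    ∃ q : ℝ → (Fin a → ℝ) → Fin r → ℝ, q 0 = f ∧
      (∀ ε ≠ 0, ∃ Q : Fin r → MvPolynomial (Fin a) ℝ,
        ∀ x j, q ε x j = MvPolynomial.eval x (Q j)) ∧
      ∀ x, JetContinuousAt m q 0 x := by
  classical
  obtain ⟨ρ, φ, hρ⟩ := exists_mvPolynomial_near_normed_bump a
  refine ⟨fun ε : ℝ => if ε = 0 then f else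
      (fun t => MvPolynomial.eval t (ρ ε)) ⋆[lsmul ℝ ℝ, volume] f, by simp, fun ε hε => ?_,
      fun x => by convert jetContinuousAt_convolution_mvPolynomial hρ hf hfc x⟩
  have hfj : ∀ j, Continuous fun t => f t j := fun j => (continuous_apply j).comp hf.continuous
  have hfcj : ∀ j, HasCompactSupport fun t => f t j := fun j =>
    hfc.comp_left (g := fun v : Fin r → ℝ => v j) rfl
  choose Q hQ using fun j => exists_mvPolynomial_eq_convolution (ρ ε) (hfj j) (hfcj j)
  refine ⟨Q, fun x j => ?_⟩
  rw [← hQ]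
  simp only [if_neg hε]
  rw [convolution_eq_swap, eval_integral]
  · simp
  · intro i
    refine Continuous.integrable_of_hasCompactSupport ?_ ((hfcj i).smul_left
      (f := fun t => MvPolynomial.eval (x - t) (ρ ε)))
    have hx : Continuous fun t : Fin a → ℝ => x - t := by fun_prop
    exact ((MvPolynomial.continuous_eval _).comp hx).smul (hfj i)

end Weierstrass

/-! ### Extending maps from `U` to the ambient space -/

section Extension

/-- A map on a subset of a coordinate space is `C^m` if near each point it is the restriction of a
map of the ambient space that is `C^m` at that point. -/
def IsSmoothOfOrder {ι : Type} [Fintype ι] {F : Type} [NormedAddCommGroup F] [NormedSpace ℝ F]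
    (m : ℕ) {M : Set (ι → ℝ)} (f : M → F) : Prop :=
  ∀ x : M, ∃ G : (ι → ℝ) → F, ContDiffAt ℝ m G x ∧ ∀ᶠ y : M in 𝓝 x, G y = f y

theorem IsSmoothOfOrder.continuous {ι : Type} [Fintype ι] {F : Type} [NormedAddCommGroup F]
    [NormedSpace ℝ F] {m : ℕ} {M : Set (ι → ℝ)} {f : M → F} (hf : IsSmoothOfOrder m f) :
    Continuous f := by
  refine continuous_iff_continuousAt.2 fun x => ?_
  obtain ⟨G, hG, hGf⟩ := hf x
  exact (hG.continuousAt.comp continuous_subtype_val.continuousAt).congr hGf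

theorem IsSmoothOfOrder.exists_extension {ι : Type} [Fintype ι] {r m : ℕ} {U : Set (ι → ℝ)}
    {w : U → Fin r → ℝ} (hw : IsSmoothOfOrder m w) {K : Set U} (hK : IsCompact K) :
    ∃ W : (ι → ℝ) → Fin r → ℝ, ContDiff ℝ m W ∧ HasCompactSupport W ∧
      ∀ x ∈ K, ∀ᶠ y : U in 𝓝 x, W y = w y := by
  have hloc : ∀ x : U, ∃ (V : Set (ι → ℝ)) (G : (ι → ℝ) → Fin r → ℝ), IsOpen V ∧ (x : ι → ℝ) ∈ V ∧
      ContDiffOn ℝ m G V ∧ ∀ y : U, (y : ι → ℝ) ∈ V → G y = w y := by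
    intro x
    obtain ⟨G, hG, hGw⟩ := hw x
    rw [nhds_subtype_eq_comap, eventually_comap] at hGw
    obtain ⟨V, hV, hVo, hxV⟩ := eventually_nhds_iff.1 ((hG.eventually (by simp)).and hGw)
    exact ⟨V, G, hVo, hxV, fun y hy => (hV y hy).1.contDiffWithinAt,
      fun y hy => (hV y hy).2 y rfl⟩
  choose V G hVo hxV hG hGw using hloc
  have hK' : IsCompact (Subtype.val '' K) := hK.image continuous_subtype_val
  obtain ⟨R, hR⟩ := hK'.isBounded.subset_ball (0 : ι → ℝ)
  let V' : Set (ι → ℝ) := (⋃ x, V x) ∩ Metric.ball 0 R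
  have hV' : IsOpen V' := (isOpen_iUnion hVo).inter Metric.isOpen_ball
  have hKV : Subtype.val '' K ⊆ V' := by
    refine subset_inter ?_ hR
    rintro _ ⟨x, -, rfl⟩
    exact mem_iUnion.2 ⟨x, hxV x⟩
  obtain ⟨δ, hδ, hδV⟩ := hK'.exists_cthickening_subset_open hV' hKV
  set C := Metric.cthickening δ (Subtype.val '' K)
  have hC : IsClosed C := Metric.isClosed_cthickening
  -- These constraints are convex, so a partition of unity glues local solutions. They do not
  -- conflict because `C ⊆ V'`, and boundedness of `V'` makes the support compact.
  let t : (ι → ℝ) → Set (Fin r → ℝ) := fun y =>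
    {c | (∀ h : y ∈ U, y ∈ C → c = w ⟨y, h⟩) ∧ (y ∉ V' → c = 0)}
  obtain ⟨W, hW⟩ := exists_contMDiffMap_forall_mem_convex_of_local (n := m)
      (modelWithCornersSelf ℝ (ι → ℝ)) (t := t) (by
    intro y c hc d hd α β hα hβ hαβ
    refine ⟨fun h hy => ?_, fun hy => ?_⟩
    · rw [hc.1 h hy, hd.1 h hy, ← add_smul, hαβ, one_smul]
    · rw [hc.2 hy, hd.2 hy]; simp) (by
    intro y
    by_cases hy : y ∈ V'
    · obtain ⟨x, hx⟩ := mem_iUnion.1 hy.1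
      refine ⟨V x ∩ V', ((hVo x).inter hV').mem_nhds ⟨hx, hy⟩, G x, ?_, fun y' hy' => ?_⟩
      · exact ((hG x).mono inter_subset_left).contMDiffOn
      · exact ⟨fun h _ => hGw x ⟨y', h⟩ hy'.1, fun h => absurd hy'.2 h⟩
    · refine ⟨Cᶜ, hC.isOpen_compl.mem_nhds fun h => hy (hδV h), 0, contMDiffOn_const,
        fun y' hy' => ⟨fun _ h => absurd h hy', fun _ => rfl⟩⟩)
  refine ⟨W, W.contMDiff.contDiff, ?_, fun x hx => ?_⟩
  · refine HasCompactSupport.of_support_subset_isCompact (isCompact_closedBall (0 : ι → ℝ) R) ?_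
    intro y hy
    by_contra h
    exact hy ((hW y).2 fun h' => h (Metric.ball_subset_closedBall h'.2))
  · have hT : Metric.thickening δ (Subtype.val '' K) ∈ 𝓝 (x : ι → ℝ) :=
      Metric.isOpen_thickening.mem_nhds (Metric.self_subset_thickening hδ _ (mem_image_of_mem _ hx))
    filter_upwards [continuous_subtype_val.continuousAt.preimage_mem_nhds hT] with y hy
    exact (hW y).1 y.2 (Metric.thickening_subset_cthickening _ _ hy)

end Extension

/-! ### Regular functions and polynomial sections of bundles -/

section Regular

variable {ι κ : Type} {S : Set (ι → ℝ)} {T : Set (κ → ℝ)}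

/-- The function `f` is a quotient of polynomials on a Zariski neighbourhood of `x`. -/
def IsRegularFunAt (f : S → ℝ) (x : S) : Prop :=
  ∃ P Q : MvPolynomial ι ℝ, MvPolynomial.eval (x : ι → ℝ) Q ≠ 0 ∧
    ∀ y : S, MvPolynomial.eval (y : ι → ℝ) Q ≠ 0 →
      f y = MvPolynomial.eval (y : ι → ℝ) P / MvPolynomial.eval (y : ι → ℝ) Q

theorem isRegularFunAt_eval (P : MvPolynomial ι ℝ) (x : S) :
    IsRegularFunAt (fun y : S => MvPolynomial.eval (y : ι → ℝ) P) x :=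
  ⟨P, 1, by simp, by simp⟩

theorem IsRegularFunAt.add {f g : S → ℝ} {x : S} (hf : IsRegularFunAt f x)
    (hg : IsRegularFunAt g x) : IsRegularFunAt (fun y => f y + g y) x := by
  obtain ⟨P, Q, hQ, hf⟩ := hf
  obtain ⟨P', Q', hQ', hg⟩ := hg
  refine ⟨P * Q' + Q * P', Q * Q', by simp [hQ, hQ'], fun y hy => ?_⟩
  simp only [map_mul, ne_eq, mul_eq_zero, not_or] at hy
  simp only [hf y hy.1, hg y hy.2, map_add, map_mul]
  rw [div_add_div _ _ hy.1 hy.2]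

theorem IsRegularFunAt.mul {f g : S → ℝ} {x : S} (hf : IsRegularFunAt f x)
    (hg : IsRegularFunAt g x) : IsRegularFunAt (fun y => f y * g y) x := by
  obtain ⟨P, Q, hQ, hf⟩ := hf
  obtain ⟨P', Q', hQ', hg⟩ := hg
  refine ⟨P * P', Q * Q', by simp [hQ, hQ'], fun y hy => ?_⟩
  simp only [map_mul, ne_eq, mul_eq_zero, not_or] at hy
  simp only [hf y hy.1, hg y hy.2, map_mul]
  rw [div_mul_div_comm]

theorem IsRegularFunAt.sum {α : Type*} (s : Finset α) {f : α → S → ℝ} {x : S}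
    (hf : ∀ i ∈ s, IsRegularFunAt (f i) x) : IsRegularFunAt (fun y => ∑ i ∈ s, f i y) x := by
  classical
  induction s using Finset.induction_on with
  | empty => simpa using isRegularFunAt_eval (0 : MvPolynomial ι ℝ) x
  | insert i s hi ih =>
    simp only [Finset.sum_insert hi]
    exact (hf i (by simp)).add (ih fun j hj => hf j (by simp [hj]))

theorem IsRegularFunAt.eval_comp {g : S → κ → ℝ} {x : S}
    (hg : ∀ j, IsRegularFunAt (fun y => g y j) x) (P : MvPolynomial κ ℝ) :
    IsRegularFunAt (fun y => MvPolynomial.eval (g y) P) x := by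
  induction P using MvPolynomial.induction_on with
  | C r => simpa using isRegularFunAt_eval (MvPolynomial.C r) x
  | add p q hp hq => simpa using hp.add hq
  | mul_X p i hp => simpa using hp.mul (hg i)

theorem IsRegularFunAt.comp {f : T → ℝ} {g : S → T} {x : S} (hf : IsRegularFunAt f (g x))
    (hg : ∀ j, IsRegularFunAt (fun y => (g y : κ → ℝ) j) x) :
    IsRegularFunAt (fun y => f (g y)) x := by
  obtain ⟨P, Q, hQ, hf⟩ := hf
  obtain ⟨A, B, hB, hA⟩ := IsRegularFunAt.eval_comp hg P
  obtain ⟨C, D, hD, hC⟩ := IsRegularFunAt.eval_comp hg Q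
  dsimp only at hA hC
  have hCx : MvPolynomial.eval (x : ι → ℝ) C ≠ 0 := by
    intro h
    apply hQ
    rw [hC x hD, h, zero_div]
  -- The quotient is `AD / BC`; the extra factor `D` makes the denominator vanish wherever `D` does.
  refine ⟨A * D * D, B * C * D, by simp [hB, hD, hCx], fun y hy => ?_⟩
  simp only [map_mul, ne_eq, mul_eq_zero, not_or] at hy
  obtain ⟨⟨hBy, hCy⟩, hDy⟩ := hy
  have hQy : MvPolynomial.eval (g y : κ → ℝ) Q ≠ 0 := by
    rw [hC y hDy]
    exact div_ne_zero hCy hDy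
  change f (g y) = _
  rw [hf _ hQy, hA y hBy, hC y hDy]
  simp only [map_mul]
  field_simp

theorem contDiff_eval {n : WithTop ℕ∞} [Fintype ι] (P : MvPolynomial ι ℝ) :
    ContDiff ℝ n fun x : ι → ℝ => MvPolynomial.eval x P := by
  induction P using MvPolynomial.induction_on with
  | C r => simpa using contDiff_const
  | add p q hp hq => simpa using hp.add hq
  | mul_X p i hp => simpa using hp.mul (contDiff_apply ℝ ℝ i)

theorem IsRegularMap.exists_contDiffAt [Fintype ι] [Fintype κ] {f : S → T} (hf : IsRegularMap f)
    (x : S) : ∃ F : (ι → ℝ) → κ → ℝ, ContDiffAt ℝ ∞ F x ∧ ∀ᶠ y : S in 𝓝 x, F y = f y := by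
  choose P Q hQ h using fun j => hf j x
  refine ⟨fun y j => MvPolynomial.eval y (P j) / MvPolynomial.eval y (Q j), ?_, ?_⟩
  · rw [contDiffAt_pi]
    exact fun j => (contDiff_eval (P j)).contDiffAt.div (contDiff_eval (Q j)).contDiffAt (hQ j)
  · have : ∀ᶠ y : S in 𝓝 x, ∀ j, MvPolynomial.eval (y : ι → ℝ) (Q j) ≠ 0 :=
      eventually_all.2 fun j => ((MvPolynomial.continuous_eval (Q j)).comp
        continuous_subtype_val).continuousAt.eventually_ne (hQ j)
    filter_upwards [this] with y hy
    exact funext fun j => (h j y (hy j)).symm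

/-- Near each point, an algebraic vector bundle has global polynomial sections that span the
fibre at this point. -/
theorem AlgVectorBundle.exists_polynomial_sections {Z : Set (κ → ℝ)} (E : AlgVectorBundle Z)
    (z : Z) : ∃ (r : ℕ) (σ : Fin r → Fin E.N → MvPolynomial κ ℝ),
      (∀ y : Z, ∀ i, (fun j => MvPolynomial.eval (y : κ → ℝ) (σ i j)) ∈ E.fiber y) ∧
      E.fiber z ≤ Submodule.span ℝ
        (Set.range fun i j => MvPolynomial.eval (z : κ → ℝ) (σ i j)) := by
  classical
  obtain ⟨W, hW, r, e, ⟨A, rfl⟩, hzW, he, hspan⟩ := E.locally_trivial z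
  obtain ⟨hzZ, R, hRA, hR⟩ := hzW
  choose P Q hQ h using fun i j => he i j ⟨z, hzZ, R, hRA, hR⟩
  -- A common denominator of the frame, times the `R` that defines a Zariski neighbourhood. The
  -- vectors `D * D' i j * P i j` equal `D² • e i` where `D ≠ 0` and vanish elsewhere, so they lie
  -- in the fibre over every point of `Z`.
  let D : MvPolynomial κ ℝ := R * ∏ p : Fin r × Fin E.N, Q p.1 p.2
  let D' : Fin r → Fin E.N → MvPolynomial κ ℝ := fun i j =>
    R * ∏ p ∈ Finset.univ.erase (i, j), Q p.1 p.2
  have hD : ∀ i j, D = D' i j * Q i j := fun i j => by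
    rw [mul_assoc, Finset.prod_erase_mul _ (fun p : Fin r × Fin E.N => Q p.1 p.2)
      (Finset.mem_univ (i, j))]
  have key : ∀ (y : κ → ℝ) (hy : y ∈ Z) (hDy : MvPolynomial.eval y D ≠ 0),
      ∃ hyW : y ∈ {x | x ∈ Z ∧ ∃ P ∈ A, MvPolynomial.eval x P ≠ 0}, ∀ i,
        (fun j => MvPolynomial.eval y (D * D' i j * P i j)) =
          (MvPolynomial.eval y D) ^ 2 • e i ⟨y, hyW⟩ := by
    intro y hy hDy
    have hRy : MvPolynomial.eval y R ≠ 0 := by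
      intro h0; apply hDy; simp [D, h0]
    refine ⟨⟨hy, R, hRA, hRy⟩, fun i => funext fun j => ?_⟩
    have hQy : MvPolynomial.eval y (Q i j) ≠ 0 := by
      intro h0; apply hDy; rw [hD i j]; simp [h0]
    have h1 := h i j ⟨y, hy, R, hRA, hRy⟩ hQy
    have h2 : MvPolynomial.eval y D = MvPolynomial.eval y (D' i j) * MvPolynomial.eval y (Q i j) := by
      rw [hD i j, map_mul]
    simp only [map_mul, Pi.smul_apply, smul_eq_mul, h1, pow_two]
    field_simp
    rw [h2]; ring
  refine ⟨r, fun i j => D * D' i j * P i j, fun y i => ?_, ?_⟩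
  · by_cases hDy : MvPolynomial.eval (y : κ → ℝ) D = 0
    · have : (fun j => MvPolynomial.eval (y : κ → ℝ) (D * D' i j * P i j)) = 0 := by
        ext j; simp [hDy]
      rw [this]
      exact Submodule.zero_mem _
    · obtain ⟨hyW, hy⟩ := key y y.2 hDy
      rw [hy i, ← (hspan ⟨y, hyW⟩).2]
      exact Submodule.smul_mem _ _ (Submodule.subset_span (mem_range_self i))
  · have hDz : MvPolynomial.eval (z : κ → ℝ) D ≠ 0 := by
      simp only [D, map_mul, map_prod]
      exact mul_ne_zero hR (Finset.prod_ne_zero_iff.2 fun p _ => hQ p.1 p.2)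
    obtain ⟨hzW, hz⟩ := key z z.2 hDz
    have hs := (hspan ⟨z, hzW⟩).2
    change _ = E.fiber z at hs
    rw [← hs, Submodule.span_le]
    rintro _ ⟨i, rfl⟩
    have h1 := hz i
    have : e i ⟨z, hzW⟩ = ((MvPolynomial.eval (z : κ → ℝ) D) ^ 2)⁻¹ •
        (fun j => MvPolynomial.eval (z : κ → ℝ) (D * D' i j * P i j)) := by
      rw [h1, smul_smul, inv_mul_cancel₀ (pow_ne_zero 2 hDz), one_smul]
    simp only [SetLike.mem_coe]
    rw [this]
    exact Submodule.smul_mem _ _ (Submodule.subset_span ⟨i, rfl⟩)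

end Regular

/-! ### Tangent vectors, curves and local separation of points -/

section Tangent

variable {ι κ : Type} [Fintype ι] [Fintype κ]

/-- The differential of a polynomial. -/
noncomputable def polyDifferential (P : MvPolynomial ι ℝ) (x : ι → ℝ) : (ι → ℝ) →L[ℝ] ℝ :=
  ∑ i, polyGradient P x i • ContinuousLinearMap.proj i

theorem polyDifferential_apply (P : MvPolynomial ι ℝ) (x v : ι → ℝ) :
    polyDifferential P x v = ∑ i, polyGradient P x i * v i := by
  simp [polyDifferential]

theorem hasStrictFDerivAt_eval (P : MvPolynomial ι ℝ) (x : ι → ℝ) :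
    HasStrictFDerivAt (fun y : ι → ℝ => MvPolynomial.eval y P) (polyDifferential P x) x := by
  classical
  induction P using MvPolynomial.induction_on with
  | C r =>
    have : polyDifferential (MvPolynomial.C r) x = 0 := by
      ext v; simp [polyDifferential_apply, polyGradient]
    rw [this]
    simpa using hasStrictFDerivAt_const r x
  | add p q hp hq =>
    have : polyDifferential (p + q) x = polyDifferential p x + polyDifferential q x := by
      ext v
      simp [polyDifferential_apply, polyGradient, add_mul, Finset.sum_add_distrib]
    rw [this]
    simp only [map_add]
    exact hp.add hq
  | mul_X p i hp =>
    have : polyDifferential (p * MvPolynomial.X i) x =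
        MvPolynomial.eval x p • ContinuousLinearMap.proj i + x i • polyDifferential p x := by
      ext v
      simp only [polyDifferential_apply, polyGradient, Derivation.leibniz, MvPolynomial.pderiv_X,
        add_apply, smul_apply,
        ContinuousLinearMap.proj_apply, smul_eq_mul, map_add, map_mul, MvPolynomial.eval_X,
        add_mul, Finset.sum_add_distrib, Finset.mul_sum]
      congr 1
      · rw [Finset.sum_eq_single i]
        · simp
        · intro j _ hj
          simp [hj.symm]
        · simp
      · exact Finset.sum_congr rfl fun j _ => by ring
    rw [this]
    simp only [map_mul, MvPolynomial.eval_X]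
    exact hp.mul (hasStrictFDerivAt_apply i x)

/-- Vectors annihilated by the differentials of local equations of `X` are velocities of curves
in `X`. -/
theorem exists_curve_of_polyDifferential_eq_zero {X : Set (ι → ℝ)} {x : ι → ℝ} {c : ℕ}
    {P : Fin c → MvPolynomial ι ℝ} (hPx : ∀ i, MvPolynomial.eval x (P i) = 0)
    (hli : LinearIndependent ℝ fun i => polyGradient (P i) x)
    (hX : ∀ᶠ y in 𝓝 x, (∀ i, MvPolynomial.eval y (P i) = 0) → y ∈ X) {v : ι → ℝ}
    (hv : ∀ i, polyDifferential (P i) x v = 0) :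
    ∃ γ : ℝ → ι → ℝ, γ 0 = x ∧ HasDerivAt γ v 0 ∧ ∀ᶠ t in 𝓝 0, γ t ∈ X := by
  let f : (ι → ℝ) → Fin c → ℝ := fun y i => MvPolynomial.eval y (P i)
  let f' : (ι → ℝ) →L[ℝ] Fin c → ℝ := ContinuousLinearMap.pi fun i => polyDifferential (P i) x
  have hf : HasStrictFDerivAt f f' x :=
    hasStrictFDerivAt_pi.2 fun i => hasStrictFDerivAt_eval (P i) x
  have hfx : f x = 0 := funext hPx
  have hsurj : f'.range = ⊤ := by
    let M : Matrix (Fin c) ι ℝ := Matrix.of fun i => polyGradient (P i) x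
    have hM : M.mulVecLin = (f' : (ι → ℝ) →ₗ[ℝ] Fin c → ℝ) := by
      apply LinearMap.ext
      intro w
      funext i
      simp [M, f', polyDifferential_apply, Matrix.mulVec, dotProduct]
    have hr : M.rank = Fintype.card (Fin c) := LinearIndependent.rank_matrix (M := M) hli
    rw [Matrix.rank, hM] at hr
    refine Submodule.eq_top_of_finrank_eq ?_
    rw [Module.finrank_fintype_fun_eq_card]
    exact hr
  let w : f'.ker := ⟨v, by
    rw [LinearMap.mem_ker]
    exact funext fun i => hv i⟩
  have hline : HasDerivAt (fun t : ℝ => t • w) w 0 := by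
    simpa using (hasDerivAt_id (0 : ℝ)).smul_const w
  -- The curve is the image of the line `t • w` in the kernel under the implicit parametrization of
  -- the level set `f = 0`, whose derivative at the origin is the inclusion of the kernel.
  refine ⟨fun t => hf.implicitFunction f f' hsurj (f x) (t • w), by simp, ?_, ?_⟩
  · have h := hf.to_implicitFunction hsurj
    have h' := HasFDerivAt.comp_hasDerivAt_of_eq (0 : ℝ) h.hasFDerivAt hline (by simp)
    exact h'
  · have h0 : Tendsto (fun t : ℝ => t • w) (𝓝 0) (𝓝 0) := by
      simpa using hline.continuousAt.tendsto
    have h1 := hf.tendsto_implicitFunction hsurj (tendsto_const_nhds (x := f x)) h0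
    have h2 := (tendsto_const_nhds (x := f x)).prodMk_nhds h0
    filter_upwards [h1.eventually hX, h2.eventually (hf.map_implicitFunction_eq hsurj)]
      with t ht ht'
    refine ht fun i => ?_
    have := congrFun ht' i
    simp only [hfx] at this ⊢
    exact this

/-- Derivatives within `S` need not be unique as linear maps, but any two of them agree on
velocities of curves in `S`. This makes the chosen `fderivWithin` computable from a smooth local
extension. -/
theorem differential_apply_eq_of_curve {S : Set (ι → ℝ)} {T : Set (κ → ℝ)} {f : S → T} {x : S}
    {H : (ι → ℝ) → κ → ℝ} (hH : DifferentiableAt ℝ H x) (hHf : ∀ᶠ y : S in 𝓝 x, H y = f y)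
    {γ : ℝ → ι → ℝ} {v : ι → ℝ} (h0 : γ 0 = x) (hγ : HasDerivAt γ v 0)
    (hS : ∀ᶠ t in 𝓝 0, γ t ∈ S) : differential f x v = fderiv ℝ H x v := by
  set e := Function.extend (Subtype.val : S → (ι → ℝ)) (fun y => (f y : κ → ℝ)) 0 with he
  have hef : ∀ y : S, e y = f y := fun y => Subtype.val_injective.extend_apply _ _ y
  have heH : e =ᶠ[𝓝[S] (x : ι → ℝ)] H := by
    rw [EventuallyEq, eventually_nhdsWithin_iff]
    rw [nhds_subtype_eq_comap, eventually_comap] at hHf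
    filter_upwards [hHf] with y hy hyS
    rw [hy ⟨y, hyS⟩ rfl]
    exact hef ⟨y, hyS⟩
  have hex : e x = H x := heH.self_of_nhdsWithin x.2
  have h1 : HasFDerivWithinAt e (fderiv ℝ H x) S x :=
    hH.hasFDerivAt.hasFDerivWithinAt.congr_of_eventuallyEq heH hex
  have h2 : HasFDerivWithinAt e (differential f x) S x := h1.differentiableWithinAt.hasFDerivWithinAt
  have hmaps : MapsTo γ {t | γ t ∈ S} S := fun t ht => ht
  have hw : HasDerivWithinAt γ v {t | γ t ∈ S} 0 := hγ.hasDerivWithinAt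
  have h1' := (h1.comp_hasDerivWithinAt_of_eq 0 hw hmaps h0.symm).hasDerivAt hS
  have h2' := (h2.comp_hasDerivWithinAt_of_eq 0 hw hmaps h0.symm).hasDerivAt hS
  exact h2'.unique h1'

/-- A regular map and a linear projection onto its vertical space together separate the points of
a nonsingular variety locally. -/
theorem exists_nhds_injOn_fiber {Z : Set (κ → ℝ)} {X : Set (ι → ℝ)} {h : Z → X}
    (hreg : IsRegularMap h) {z : Z} (hz : IsNonsingularAt Z z)
    {l : (κ → ℝ) →L[ℝ] verticalSpace h z} (hl : ∀ v : verticalSpace h z, l v = v) :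
    ∃ N ∈ 𝓝 (z : κ → ℝ), ∀ y y' : Z, (y : κ → ℝ) ∈ N → (y' : κ → ℝ) ∈ N → h y = h y' →
      l y = l y' → y = y' := by
  obtain ⟨c, P, hPZ, hli, hloc⟩ := hz
  obtain ⟨H, hH, hHh⟩ := hreg.exists_contDiffAt z
  have hHs : HasStrictFDerivAt H (fderiv ℝ H z) z := hH.hasStrictFDerivAt (by simp)
  let Φ : (κ → ℝ) → (Fin c → ℝ) × (ι → ℝ) × verticalSpace h z := fun y =>
    (fun i => MvPolynomial.eval y (P i), H y, l y)
  let Φ' : (κ → ℝ) →L[ℝ] (Fin c → ℝ) × (ι → ℝ) × verticalSpace h z :=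
    (ContinuousLinearMap.pi fun i => polyDifferential (P i) z).prod ((fderiv ℝ H z).prod l)
  have hΦ : HasStrictFDerivAt Φ Φ' z :=
    (hasStrictFDerivAt_pi.2 fun i => hasStrictFDerivAt_eval (P i) z).prodMk
      (hHs.prodMk l.hasStrictFDerivAt)
  -- A vector killed by the equations of `Z` is the velocity of a curve in `Z`, hence tangent;
  -- killed also by the derivative of `H`, it is vertical; there `l` is the identity, so it is zero.
  have hker : LinearMap.ker Φ'.toLinearMap = ⊥ := by
    rw [LinearMap.ker_eq_bot']
    intro v hv
    have hv1 : ∀ i, polyDifferential (P i) z v = 0 := fun i => congrFun (congrArg Prod.fst hv) i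
    have hv2 : fderiv ℝ H z v = 0 := congrArg (fun q => q.2.1) hv
    have hv3 : l v = 0 := congrArg (fun q => q.2.2) hv
    obtain ⟨γ, h0, hγ, hγZ⟩ :=
      exists_curve_of_polyDifferential_eq_zero (fun i => hPZ i z z.2) hli hloc hv1
    have hvV : v ∈ verticalSpace h z := by
      refine ⟨fun Q hQ => ?_, ?_⟩
      · rw [← polyDifferential_apply]
        have h1 := HasFDerivAt.comp_hasDerivAt_of_eq (0 : ℝ)
          (hasStrictFDerivAt_eval Q (z : κ → ℝ)).hasFDerivAt hγ h0.symm
        refine h1.unique ((hasDerivAt_const (0 : ℝ) (0 : ℝ)).congr_of_eventuallyEq ?_)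
        filter_upwards [hγZ] with t ht using hQ _ ht
      · change differential h z v = 0
        rw [differential_apply_eq_of_curve (hH.differentiableAt (by simp)) hHh h0 hγ hγZ, hv2]
    have := hl ⟨v, hvV⟩
    rw [hv3] at this
    exact (congrArg Subtype.val this).symm
  -- Following `Φ` by a left inverse of its derivative gives a self-map with identity derivative, to
  -- which the inverse function theorem applies.
  obtain ⟨Ψ, hΨ⟩ := LinearMap.exists_leftInverse_of_injective _ hker
  let Ψ' := LinearMap.toContinuousLinearMap Ψ
  have hcomp : HasStrictFDerivAt (fun y => Ψ' (Φ y))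
      ((ContinuousLinearEquiv.refl ℝ (κ → ℝ) : (κ → ℝ) →L[ℝ] (κ → ℝ))) z := by
    have h1 := Ψ'.hasStrictFDerivAt.comp (z : κ → ℝ) hΦ
    have h2 : Ψ'.comp Φ' = (ContinuousLinearEquiv.refl ℝ (κ → ℝ) : (κ → ℝ) →L[ℝ] (κ → ℝ)) := by
      apply ContinuousLinearMap.ext
      intro v
      exact LinearMap.congr_fun hΨ v
    rw [h2] at h1
    exact h1
  let e := hcomp.toOpenPartialHomeomorph _
  rw [nhds_subtype_eq_comap, eventually_comap] at hHh
  refine ⟨e.source ∩ {y | ∀ b : Z, (b : κ → ℝ) = y → H b = h b},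
    inter_mem (e.open_source.mem_nhds hcomp.mem_toOpenPartialHomeomorph_source) hHh, ?_⟩
  rintro y y' ⟨hy1, hy2⟩ ⟨hy1', hy2'⟩ hhy hly
  have hΦy : Φ y = Φ y' := by
    refine Prod.ext (funext fun i => ?_) (Prod.ext ?_ hly)
    · exact (hPZ i y y.2).trans (hPZ i y' y'.2).symm
    · change H y = H y'
      rw [hy2 y rfl, hy2' y' rfl, hhy]
  exact Subtype.ext (e.injOn hy1 hy1' (congrArg Ψ' hΦy))

end Tangent

/-! ### Sprays on product bundles and connecting points of a fibre -/

section TrivialSpray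

variable {ι κ : Type} [Fintype ι] [Fintype κ] {Z : Set (κ → ℝ)} {X : Set (ι → ℝ)} {h : Z → X}

/-- The data of a spray for `h` on a product bundle `Z × ℝʳ`. -/
structure IsTrivialSpray (h : Z → X) {r : ℕ} (S : Z → (Fin r → ℝ) → Z) : Prop where
  fiber : ∀ z u, h (S z u) = h z
  zero : ∀ z, S z 0 = z
  regular : ∀ {W : Set (ι → ℝ)} {g : W → Z}, IsRegularMap g →
    ∀ Q : Fin r → MvPolynomial ι ℝ,
      IsRegularMap fun x : W => S (g x) fun i => MvPolynomial.eval (x : ι → ℝ) (Q i)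
  smooth : ∀ (z : Z) (u : Fin r → ℝ), ∃ G : (κ → ℝ) × (Fin r → ℝ) → κ → ℝ, ContDiffAt ℝ ∞ G ((z : κ → ℝ), u) ∧
    ∀ᶠ p : Z × (Fin r → ℝ) in 𝓝 (z, u), G ((p.1 : κ → ℝ), p.2) = S p.1 p.2

/-- The vector of the fibre over `z` with coordinates `u` in given global polynomial sections. -/
noncomputable def AlgVectorBundle.combination (E : AlgVectorBundle Z) {r : ℕ}
    (σ : Fin r → Fin E.N → MvPolynomial κ ℝ)
    (hσ : ∀ y : Z, ∀ i, (fun j => MvPolynomial.eval (y : κ → ℝ) (σ i j)) ∈ E.fiber y)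
    (z : Z) (u : Fin r → ℝ) : E.fiber z :=
  ⟨∑ i, u i • fun j => MvPolynomial.eval (z : κ → ℝ) (σ i j),
    Submodule.sum_mem _ fun i _ => Submodule.smul_mem _ _ (hσ z i)⟩

variable {E : AlgVectorBundle Z} {s : E.total → Z} {r : ℕ}
  {σ : Fin r → Fin E.N → MvPolynomial κ ℝ}
  (hσ : ∀ y : Z, ∀ i, (fun j => MvPolynomial.eval (y : κ → ℝ) (σ i j)) ∈ E.fiber y)

/-- The spray is pulled back along `(z, u) ↦ ∑ uᵢ σᵢ(z)`, which is polynomial and linear in `u`. -/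
theorem IsSpray.isTrivialSpray (hs : IsSpray h E s) :
    IsTrivialSpray h fun z u => s (E.point z (E.combination σ hσ z u)) where
  fiber z u := hs.2.1 z _
  zero z := by
    have : E.combination σ hσ z 0 = 0 := Subtype.ext (by simp [AlgVectorBundle.combination])
    rw [this, hs.2.2]
  regular {W g} hg Q j x := by
    refine IsRegularFunAt.comp (f := fun q => (s q : κ → ℝ) j)
      (g := fun x : W => E.point (g x) (E.combination σ hσ (g x)
        fun i => MvPolynomial.eval (x : ι → ℝ) (Q i))) (hs.1 j _) ?_
    rintro (k | k)
    · exact hg k x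
    · simp only [AlgVectorBundle.point, AlgVectorBundle.combination, Sum.elim_inr,
        Finset.sum_apply, Pi.smul_apply, smul_eq_mul]
      exact IsRegularFunAt.sum _ fun i _ => (isRegularFunAt_eval (Q i) x).mul
        (IsRegularFunAt.eval_comp (fun j => hg j x) (σ i k))
  smooth z u := by
    obtain ⟨H, hH, hHs⟩ := hs.1.exists_contDiffAt (E.point z (E.combination σ hσ z u))
    let c : (κ → ℝ) × (Fin r → ℝ) → (κ ⊕ Fin E.N → ℝ) := fun p =>
      Sum.elim p.1 (∑ i, p.2 i • fun j => MvPolynomial.eval p.1 (σ i j))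
    have hc : ContDiff ℝ ∞ c := by
      rw [contDiff_pi]
      rintro (k | k)
      · exact (contDiff_apply ℝ ℝ k).comp contDiff_fst
      · simp only [c, Sum.elim_inr, Finset.sum_apply, Pi.smul_apply, smul_eq_mul]
        exact ContDiff.sum fun i _ => ((contDiff_apply ℝ ℝ i).comp contDiff_snd).mul
          ((contDiff_eval (σ i k)).comp contDiff_fst)
    refine ⟨fun p => H (c p), ContDiffAt.comp ((z : κ → ℝ), u) hH hc.contDiffAt, ?_⟩
    have hcont : Continuous fun p : Z × (Fin r → ℝ) =>
        E.point p.1 (E.combination σ hσ p.1 p.2) := by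
      refine Continuous.subtype_mk ?_ _
      exact hc.continuous.comp (continuous_subtype_val.prodMap continuous_id)
    exact (hcont.tendsto (z, u)).eventually hHs

/-- Domination gives `v` as the image of some `e` in the fibre, and `u` holds coordinates of `e` in
the spanning sections. Both derivatives are read off the one curve `t ↦ s(t e)`. -/
theorem IsDominating.exists_fderiv_eq (hs : IsSpray h E s) (hd : IsDominating h E s) {z : Z}
    (hz : E.fiber z ≤ Submodule.span ℝ
        (Set.range fun i j => MvPolynomial.eval (z : κ → ℝ) (σ i j)))
    {G : (κ → ℝ) × (Fin r → ℝ) → κ → ℝ} (hG : DifferentiableAt ℝ G ((z : κ → ℝ), 0))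
    (hGs : ∀ᶠ p : Z × (Fin r → ℝ) in 𝓝 (z, 0),
      G ((p.1 : κ → ℝ), p.2) = s (E.point p.1 (E.combination σ hσ p.1 p.2)))
    {v : κ → ℝ} (hv : v ∈ verticalSpace h z) :
    ∃ u : Fin r → ℝ, fderiv ℝ G ((z : κ → ℝ), 0) (0, u) = v := by
  rw [← hd z] at hv
  obtain ⟨_, ⟨e, he, rfl⟩, hev⟩ := hv
  obtain ⟨u, hu⟩ := (Submodule.mem_span_range_iff_exists_fun ℝ).1 (hz he)
  refine ⟨u, ?_⟩
  obtain ⟨H, hH, hHs⟩ := hs.1.exists_contDiffAt (E.point z 0)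
  let γ : ℝ → (κ ⊕ Fin E.N → ℝ) := fun t => Sum.elim (z : κ → ℝ) (t • e)
  have hγp : ∀ t : ℝ, γ t = E.point z (E.combination σ hσ z (t • u)) := by
    intro t
    simp only [γ, AlgVectorBundle.point, AlgVectorBundle.combination, ← hu, Finset.smul_sum,
      smul_smul, Pi.smul_apply, smul_eq_mul]
  have hγ0 : γ 0 = E.point z 0 := by simp [γ, AlgVectorBundle.point]
  have hγ : HasDerivAt γ (Sum.elim (0 : κ → ℝ) e) 0 := by
    rw [hasDerivAt_pi]
    rintro (k | k)
    · exact hasDerivAt_const _ _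
    · simpa [γ] using (hasDerivAt_id (0 : ℝ)).mul_const (e k)
  have h1 := differential_apply_eq_of_curve (hH.differentiableAt (by simp)) hHs hγ0 hγ
    (Eventually.of_forall fun t => by rw [hγp]; exact Subtype.coe_prop _)
  have hev' : differential s (E.point z 0) (Sum.elim (0 : κ → ℝ) e) = v := hev
  rw [h1] at hev'
  have h2 := HasFDerivAt.comp_hasDerivAt_of_eq (0 : ℝ)
    (hH.differentiableAt (by simp)).hasFDerivAt hγ hγ0.symm
  have hline : HasDerivAt (fun t : ℝ => ((z : κ → ℝ), t • u)) (0, u) 0 := by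
    simpa using (hasDerivAt_const (0 : ℝ) (z : κ → ℝ)).prodMk
      ((hasDerivAt_id (0 : ℝ)).smul_const u)
  have h3 := HasFDerivAt.comp_hasDerivAt_of_eq (0 : ℝ) hG.hasFDerivAt hline (by simp)
  rw [hev'] at h2
  refine h3.unique (h2.congr_of_eventuallyEq ?_)
  have hl : Tendsto (fun t : ℝ => (z, t • u)) (𝓝 0) (𝓝 (z, (0 : Fin r → ℝ))) := by
    refine tendsto_const_nhds.prodMk_nhds ?_
    have hc : Continuous fun t : ℝ => t • u := by fun_prop
    simpa using hc.tendsto 0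
  have hl' : Tendsto (fun t : ℝ => E.point z (E.combination σ hσ z (t • u))) (𝓝 0)
      (𝓝 (E.point z 0)) := by
    rw [tendsto_subtype_rng, ← hγ0]
    refine (hγ.continuousAt.tendsto).congr hγp
  filter_upwards [hl.eventually hGs, hl'.eventually hHs] with t ht ht'
  change G ((z : κ → ℝ), t • u) = H (γ t)
  rw [ht, hγp, ht']

theorem eventually_nhds_ambient {α : Type} [TopologicalSpace α] {z : Z} {u : α}
    {P : Z × α → Prop} (hP : ∀ᶠ p in 𝓝 (z, u), P p) :
    ∀ᶠ p : (κ → ℝ) × α in 𝓝 ((z : κ → ℝ), u), ∀ hp : p.1 ∈ Z, P (⟨p.1, hp⟩, p.2) := by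
  have hi : Topology.IsInducing (Prod.map Subtype.val id : Z × α → (κ → ℝ) × α) :=
    Topology.IsInducing.subtypeVal.prodMap Topology.IsInducing.id
  rw [hi.nhds_eq_comap, eventually_comap] at hP
  filter_upwards [hP] with p hp hpZ
  exact hp (⟨p.1, hpZ⟩, p.2) rfl

/-- A dominating spray provides, near each point, a trivial spray that connects nearby points of
the same fibre, with parameters depending smoothly on the two points. -/
theorem exists_trivialSpray_connecting (hreg : IsRegularMap h) (hmal : IsMalleable h) {z₀ : Z}
    (hz₀ : IsNonsingularAt Z z₀) (m : ℕ) :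
    ∃ (r : ℕ) (S : Z → (Fin r → ℝ) → Z) (θ : (κ → ℝ) × (κ → ℝ) → Fin r → ℝ) (N : Set (κ → ℝ)),
      IsTrivialSpray h S ∧ IsOpen N ∧ (z₀ : κ → ℝ) ∈ N ∧
      (∀ z ∈ N, ∀ z' ∈ N, ContDiffAt ℝ m θ (z, z')) ∧
      (∀ z : Z, (z : κ → ℝ) ∈ N → θ ((z : κ → ℝ), (z : κ → ℝ)) = 0) ∧
      ∀ z z' : Z, (z : κ → ℝ) ∈ N → (z' : κ → ℝ) ∈ N → h z = h z' →
        S z (θ ((z : κ → ℝ), (z' : κ → ℝ))) = z' := by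
  obtain ⟨E, s, hs, hd⟩ := hmal
  obtain ⟨r, σ, hσ, hspan⟩ := E.exists_polynomial_sections z₀
  have hS := hs.isTrivialSpray hσ
  obtain ⟨G, hG, hGS⟩ := hS.smooth z₀ 0
  have hdom : ∀ v : verticalSpace h z₀, ∃ u, fderiv ℝ G ((z₀ : κ → ℝ), 0) (0, u) = v := fun v =>
    hd.exists_fderiv_eq hσ hs hspan (hG.differentiableAt (by simp)) hGS v.2
  set S : Z → (Fin r → ℝ) → Z := fun z u => s (E.point z (E.combination σ hσ z u))
  set V := verticalSpace h z₀
  obtain ⟨l₀, hl₀⟩ := V.subtype.exists_leftInverse_of_injective (Submodule.ker_subtype V)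
  let l : (κ → ℝ) →L[ℝ] V := LinearMap.toContinuousLinearMap l₀
  have hl : ∀ v : V, l v = v := fun v => LinearMap.congr_fun hl₀ v
  obtain ⟨N₀, hN₀, hinj⟩ := exists_nhds_injOn_fiber hreg hz₀ hl
  let D : (Fin r → ℝ) →L[ℝ] κ → ℝ :=
    (fderiv ℝ G ((z₀ : κ → ℝ), 0)).comp (ContinuousLinearMap.inr ℝ (κ → ℝ) (Fin r → ℝ))
  -- A linear choice of spray parameters realizing each vertical vector at `z₀`.
  obtain ⟨μ, hμ⟩ : ∃ μ : V →L[ℝ] Fin r → ℝ, ∀ v, D (μ v) = v := by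
    let b := Module.finBasis ℝ V
    choose u hu using hdom
    refine ⟨LinearMap.toContinuousLinearMap (b.constr ℝ fun i => u (b i)), fun v => ?_⟩
    have : D.toLinearMap ∘ₗ (b.constr ℝ fun i => u (b i)) = V.subtype := by
      refine b.ext fun i => ?_
      simpa [D, Module.Basis.constr_basis] using hu (b i)
    exact LinearMap.congr_fun this v
  -- The equation `l(S(z, μ y)) = l(z')` is to be solved for `y ∈ V`. Its derivative in `y` at the
  -- base point is `l ∘ D ∘ μ = id`.
  let f : ((κ → ℝ) × (κ → ℝ)) × V → V := fun p => l (G (p.1.1, μ p.2)) - l p.1.2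
  let p₀ : (κ → ℝ) × (κ → ℝ) := ((z₀ : κ → ℝ), (z₀ : κ → ℝ))
  have hG0 : G ((z₀ : κ → ℝ), 0) = z₀ := by
    have h0 : G ((z₀ : κ → ℝ), 0) = S z₀ 0 := hGS.self_of_nhds
    rw [h0, hS.zero]
  have hf : ContDiffAt ℝ ∞ f (p₀, 0) := by
    have hG' : ContDiffAt ℝ ∞ G ((z₀ : κ → ℝ), μ 0) := by simpa using hG
    have h1 : ContDiffAt ℝ ∞ (fun p : ((κ → ℝ) × (κ → ℝ)) × V => (p.1.1, μ p.2)) (p₀, 0) := by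
      fun_prop
    have h2 := ContDiffAt.comp (p₀, (0 : V)) hG' h1
    exact (l.contDiff.contDiffAt.comp (p₀, (0 : V)) h2).sub (by fun_prop)
  have hf0 : f (p₀, 0) = 0 := by simp [f, p₀, hG0]
  have hfd : fderiv ℝ f (p₀, 0) ∘L .inr ℝ ((κ → ℝ) × (κ → ℝ)) V = .id ℝ V := by
    have h1 : HasFDerivAt (fun y : V => f (p₀, y))
        (fderiv ℝ f (p₀, 0) ∘L .inr ℝ ((κ → ℝ) × (κ → ℝ)) V) 0 :=
      (hf.differentiableAt (by simp)).hasFDerivAt.comp (0 : V) (hasFDerivAt_prodMk_right p₀ 0)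
    have h2 : HasFDerivAt (fun y : V => f (p₀, y)) (.id ℝ V) 0 := by
      have hμ' : HasFDerivAt (fun y : V => ((z₀ : κ → ℝ), μ y))
          ((ContinuousLinearMap.inr ℝ (κ → ℝ) (Fin r → ℝ)).comp μ) 0 :=
        (hasFDerivAt_prodMk_right (z₀ : κ → ℝ) (μ 0)).comp (0 : V) μ.hasFDerivAt
      have hG' : HasFDerivAt G (fderiv ℝ G ((z₀ : κ → ℝ), 0)) ((z₀ : κ → ℝ), μ 0) := by
        simpa using (hG.differentiableAt (by simp)).hasFDerivAt
      have h3 := (l.hasFDerivAt.comp (0 : V) (hG'.comp (0 : V) hμ')).sub_const (l z₀)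
      refine h3.congr_fderiv ?_
      apply ContinuousLinearMap.ext
      intro v
      have : l (D (μ v)) = v := by rw [hμ, hl]
      exact this
    exact h1.unique h2
  have hinv : (fderiv ℝ f (p₀, 0) ∘L .inr ℝ ((κ → ℝ) × (κ → ℝ)) V).IsInvertible := by
    rw [hfd]
    exact ⟨ContinuousLinearEquiv.refl ℝ V, rfl⟩
  let Y := hf.implicitFunction (by simp) hinv
  have hY : ContDiffAt ℝ ∞ Y p₀ := hf.contDiffAt_implicitFunction (by simp) hinv
  have hY0 : Y p₀ = 0 := hf.implicitFunction_apply_self (by simp) hinv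
  let θ : (κ → ℝ) × (κ → ℝ) → Fin r → ℝ := fun p => μ (Y p)
  have hθ : ContDiffAt ℝ ∞ θ p₀ := μ.contDiff.contDiffAt.comp p₀ hY
  have hθ0 : θ p₀ = 0 := by simp [θ, hY0]
  have hGS' := eventually_nhds_ambient hGS
  have t1 : Tendsto (fun p : (κ → ℝ) × (κ → ℝ) => (p.1, θ p)) (𝓝 p₀) (𝓝 ((z₀ : κ → ℝ), 0)) := by
    rw [← hθ0]
    exact (continuousAt_fst.prodMk hθ.continuousAt).tendsto
  have t2 : Tendsto (fun p : (κ → ℝ) × (κ → ℝ) => (p.1, (0 : Fin r → ℝ))) (𝓝 p₀)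
      (𝓝 ((z₀ : κ → ℝ), 0)) := (continuousAt_fst.prodMk continuousAt_const).tendsto
  have t3 : Tendsto (fun p : (κ → ℝ) × (κ → ℝ) => (p, (0 : V))) (𝓝 p₀) (𝓝 (p₀, 0)) :=
    (continuousAt_id.prodMk continuousAt_const).tendsto
  have t4 : Tendsto (fun p : (κ → ℝ) × (κ → ℝ) => G (p.1, θ p)) (𝓝 p₀) (𝓝 (z₀ : κ → ℝ)) := by
    have ht := hG.continuousAt.tendsto.comp t1
    rwa [hG0] at ht
  have t5 : Tendsto (fun p : (κ → ℝ) × (κ → ℝ) => p.2) (𝓝 p₀) (𝓝 (z₀ : κ → ℝ)) :=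
    continuousAt_snd.tendsto
  have hev := ((hθ.of_le (m := m) (by exact_mod_cast le_top)).eventually (by simp)).and
    ((hf.eventually_apply_implicitFunction (by simp) hinv).and
    ((t3.eventually (hf.eventually_apply_eq_iff_implicitFunction (by simp) hinv)).and
    ((t1.eventually hGS').and ((t2.eventually hGS').and
    ((t4.eventually hN₀).and (t5.eventually hN₀))))))
  obtain ⟨A, hA, B, hB, hAB⟩ := mem_nhds_prod_iff.1 hev
  obtain ⟨N, hN, hNo, hzN⟩ := mem_nhds_iff.1 (inter_mem hA hB)
  have key := fun z (hz : z ∈ N) z' (hz' : z' ∈ N) =>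
    hAB (show (z, z') ∈ A ×ˢ B from ⟨(hN hz).1, (hN hz').2⟩)
  refine ⟨r, S, θ, N, hS, hNo, hzN, fun z hz z' hz' => (key z hz z' hz').1, fun z hz => ?_,
    fun z z' hz hz' hh => ?_⟩
  · obtain ⟨-, -, h3, -, h5, -⟩ := key z hz z hz
    have hGz : G ((z : κ → ℝ), 0) = z := by
      have h0 : G ((z : κ → ℝ), 0) = S z 0 := h5 z.2
      rw [h0, hS.zero]
    -- At `z' = z` the value `0` is a solution, so local uniqueness forces it.
    have : Y ((z : κ → ℝ), (z : κ → ℝ)) = 0 := h3.1 (by rw [hf0]; simp [f, hGz])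
    simp [θ, this]
  · obtain ⟨-, h2, -, h4, -, h6, h7⟩ := key z hz z' hz'
    have h4' : G ((z : κ → ℝ), θ ((z : κ → ℝ), (z' : κ → ℝ))) =
      S z (θ ((z : κ → ℝ), (z' : κ → ℝ))) := h4 z.2
    -- Both points lie in one fibre of `h` and have the same image under `l`, and these data
    -- separate points of `Z` near `z₀`.
    refine hinj _ _ ?_ h7 ((hS.fiber _ _).trans hh) ?_
    · rw [← h4']; exact h6
    · rw [← h4']
      rw [hf0] at h2
      exact sub_eq_zero.1 h2

end TrivialSpray

/-! ### Limits of regular sections -/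

section Approximable

variable {ι κ : Type} [Fintype ι] [Fintype κ] {Z : Set (κ → ℝ)} {X U : Set (ι → ℝ)} {h : Z → X}

theorem IsSmooth.isSmoothOfOrder {M : Set (ι → ℝ)} {f : M → κ → ℝ} (hf : IsSmooth f) (m : ℕ) :
    IsSmoothOfOrder m f := fun x => by
  obtain ⟨G, hG, hGf⟩ := hf x
  exact ⟨G, hG.of_le (by exact_mod_cast le_top), hGf⟩

theorem tendsto_chart_symm {α β : Type} [TopologicalSpace α] [TopologicalSpace β]
    (φ : OpenPartialHomeomorph α β) {x : α} (hx : x ∈ φ.source) :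
    Tendsto φ.symm (𝓝 (φ x)) (𝓝 x) := by
  simpa [hx] using (φ.symm.continuousAt (φ.map_source hx)).tendsto

theorem IsSmoothChart.contDiffAt_symm {d : ℕ} {φ : OpenPartialHomeomorph U (Fin d → ℝ)}
    (hφ : IsSmoothChart φ) {x : U} (hx : x ∈ φ.source) (m : ℕ) :
    ContDiffAt ℝ m (fun y => (φ.symm y : ι → ℝ)) (φ x) :=
  ((hφ.2 _ (φ.map_source hx)).contDiffAt (φ.open_target.mem_nhds (φ.map_source hx))).of_le
    (by exact_mod_cast le_top)

theorem IsSmoothOfOrder.contDiffAt_comp_chart_symm {F : Type} [NormedAddCommGroup F]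
    [NormedSpace ℝ F] {m : ℕ} {c : U → F} (hc : IsSmoothOfOrder m c) {d : ℕ}
    {φ : OpenPartialHomeomorph U (Fin d → ℝ)} (hφ : IsSmoothChart φ) {x : U} (hx : x ∈ φ.source) :
    ContDiffAt ℝ m (fun y => c (φ.symm y)) (φ x) := by
  obtain ⟨G, hG, hGc⟩ := hc x
  have hG' : ContDiffAt ℝ m G (φ.symm (φ x) : U) := by rwa [φ.left_inv hx]
  refine (ContDiffAt.comp (φ x) hG' (hφ.contDiffAt_symm hx m)).congr_of_eventuallyEq ?_
  filter_upwards [(tendsto_chart_symm φ hx).eventually hGc] with y hy using hy.symm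

/-- As `ε → 0`, the maps `g ε` converge to `g 0` together with the derivatives of order at most
`m`, uniformly near each point of `K`. -/
def JetConverges (m : ℕ) (K : Set U) (g : ℝ → U → Z) : Prop :=
  ∀ x ∈ K, ∀ (d : ℕ) (φ : OpenPartialHomeomorph U (Fin d → ℝ)), IsSmoothChart φ → x ∈ φ.source →
    JetContinuousAt m (fun ε y => (g ε (φ.symm y) : κ → ℝ)) 0 (φ x)

/-- The map `c` is a `C^m` limit, near `K`, of regular sections. -/
def IsApproximable (h : Z → X) (m : ℕ) (K : Set U) (c : U → Z) : Prop :=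
  ∃ g : ℝ → U → Z, g 0 = c ∧ (∀ ε ≠ 0, IsRegularSection h (g ε)) ∧ JetConverges m K g

variable {m : ℕ} {K : Set U} {c c' : U → Z}

/-- Only the member at `ε = 0` is replaced, and convergence at points of `K` sees only its germs
there. -/
theorem IsApproximable.congr (hc : IsApproximable h m K c)
    (hcc' : ∀ x ∈ K, ∀ᶠ y in 𝓝 x, c y = c' y) : IsApproximable h m K c' := by
  classical
  obtain ⟨g, rfl, hgr, hg⟩ := hc
  refine ⟨fun ε => if ε = 0 then c' else g ε, by simp, fun ε hε => by simpa [hε] using hgr ε hε,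
    fun x hx d φ hφ hxφ => (hg x hx d φ hφ hxφ).congr ?_⟩
  have := (tendsto_chart_symm φ hxφ).eventually (hcc' x hx)
  filter_upwards [(continuous_snd.tendsto ((0 : ℝ), φ x)).eventually this] with p hp
  by_cases hp0 : p.1 = 0
  · simp [hp0, hp]
  · simp [hp0]

theorem IsRegularSection.isSmooth {g : U → Z} (hg : IsRegularSection h g) :
    IsSmooth fun x => (g x : κ → ℝ) := by
  obtain ⟨W, hUW, g', -, -, hg', hgg'⟩ := hg
  intro x
  obtain ⟨G, hG, hGg⟩ := hg'.exists_contDiffAt ⟨x, hUW x.2⟩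
  refine ⟨G, hG, ?_⟩
  have hc : Continuous (inclusion hUW) := continuous_inclusion hUW
  filter_upwards [(hc.tendsto x).eventually hGg] with y hy
  rw [← hgg' y]
  exact hy

theorem IsRegularSection.isApproximable {g : U → Z} (hg : IsRegularSection h g) :
    IsApproximable h m K g :=
  ⟨fun _ => g, rfl, fun _ _ => hg, fun _ _ _ _ hφ hxφ => jetContinuousAt_const
    ((hg.isSmooth.isSmoothOfOrder m).contDiffAt_comp_chart_symm hφ hxφ)⟩

theorem IsTrivialSpray.isRegularSection {r : ℕ} {S : Z → (Fin r → ℝ) → Z}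
    (hS : IsTrivialSpray h S) {g : U → Z} (hg : IsRegularSection h g)
    (Q : Fin r → MvPolynomial ι ℝ) :
    IsRegularSection h fun x => S (g x) fun i => MvPolynomial.eval (x : ι → ℝ) (Q i) := by
  obtain ⟨W, hUW, g', hW, hs, hg', hgg'⟩ := hg
  refine ⟨W, hUW, fun x => S (g' x) fun i => MvPolynomial.eval (x : ι → ℝ) (Q i), hW, fun x => ?_,
    hS.regular hg' Q, fun x => ?_⟩
  · rw [hS.fiber]
    exact hs x
  · dsimp only
    rw [hgg' x]

end Approximable

/-! ### Approximability is preserved by sprays -/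

section SprayStep

variable {a : ℕ} {κ : Type} [Fintype κ] {Z : Set (κ → ℝ)} {X U : Set (Fin a → ℝ)} {h : Z → X}
  {m : ℕ} {K : Set U} {c : U → Z}

theorem IsApproximable.spray (hK : IsCompact K) (hc : IsApproximable h m K c) {r : ℕ}
    {S : Z → (Fin r → ℝ) → Z} (hS : IsTrivialSpray h S) {w : U → Fin r → ℝ}
    (hw : IsSmoothOfOrder m w) : IsApproximable h m K fun x => S (c x) (w x) := by
  classical
  obtain ⟨g, rfl, hgr, hg⟩ := hc
  obtain ⟨W, hWs, hWc, hWw⟩ := hw.exists_extension hK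
  obtain ⟨q, rfl, hqp, hq⟩ := exists_polynomial_jetContinuousAt hWs hWc
  -- At `ε = 0` the map `w` itself is needed: `q 0` extends it only near `K`.
  refine ⟨fun ε => if ε = 0 then fun x => S (g 0 x) (w x) else fun x => S (g ε x) (q ε x),
    by simp, fun ε hε => ?_, fun x hx d φ hφ hxφ => ?_⟩
  · obtain ⟨Q, hQ⟩ := hqp ε hε
    simp only [if_neg hε]
    convert hS.isRegularSection (hgr ε hε) Q using 3 with x
    exact funext fun j => hQ x j
  · obtain ⟨G, hG, hGS⟩ := hS.smooth (g 0 x) (w x)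
    have hxx : φ.symm (φ x) = x := φ.left_inv hxφ
    have hu := hg x hx d φ hφ hxφ
    have hv : JetContinuousAt m (fun ε y => q ε (φ.symm y : U)) 0 (φ x) :=
      (hq (φ.symm (φ x) : U)).comp (jetContinuousAt_const (hφ.contDiffAt_symm hxφ m))
    have h0 : ((g 0 (φ.symm (φ x)) : κ → ℝ), q 0 (φ.symm (φ x) : U)) =
        ((g 0 x : κ → ℝ), w x) := by
      rw [hxx, (hWw x hx).self_of_nhds]
    have hG' : ContDiffAt ℝ m G ((g 0 (φ.symm (φ x)) : κ → ℝ), q 0 (φ.symm (φ x) : U)) := by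
      rw [h0]
      exact hG.of_le (by exact_mod_cast le_top)
    have hjet := (jetContinuousAt_const (T := ℝ) (τ := 0) hG').comp (hu.prodMk hv)
    refine hjet.congr ?_
    have hlim : Tendsto (fun p : ℝ × (Fin d → ℝ) =>
        (g p.1 (φ.symm p.2), q p.1 (φ.symm p.2 : U))) (𝓝 (0, φ x)) (𝓝 (g 0 x, w x)) := by
      refine Tendsto.prodMk_nhds (tendsto_subtype_rng.2 ?_) ?_
      · simpa [hxx] using hu.continuousAt.tendsto
      · have := hv.continuousAt.tendsto
        simpa [hxx, (hWw x hx).self_of_nhds] using this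
    have hsym := (continuous_snd.tendsto ((0 : ℝ), φ x)).eventually
      ((tendsto_chart_symm φ hxφ).eventually (hWw x hx))
    filter_upwards [hlim.eventually hGS, hsym] with p hp hpw
    by_cases hp0 : p.1 = 0
    · rw [hp0] at hp ⊢
      simp only [if_true, ← hpw]
      exact hp
    · simp only [hp0, if_false]
      exact hp

end SprayStep

/-! ### From approximability to the weak topology -/

section WeakTopology

variable {ι κ : Type} [Fintype ι] [Fintype κ] {Z : Set (κ → ℝ)} {U : Set (ι → ℝ)}

theorem contDiffAt_chart_expression {f : SmoothMap U Z} {d e : ℕ}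
    {φ : OpenPartialHomeomorph U (Fin d → ℝ)} {ψ : OpenPartialHomeomorph Z (Fin e → ℝ)}
    (hφ : IsSmoothChart φ) (hψ : IsSmoothChart ψ) {x : U} (hx : x ∈ φ.source)
    (hfx : f.toFun x ∈ ψ.source) (m : ℕ) :
    ContDiffAt ℝ m (fun y => ψ (f.toFun (φ.symm y))) (φ x) := by
  have hf := f.smooth.isSmoothOfOrder m
  obtain ⟨G, hG, hGψ⟩ := hψ.1 _ hfx
  have hxx := φ.left_inv hx
  have hG' : ContDiffAt ℝ m G (f.toFun (φ.symm (φ x)) : κ → ℝ) := by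
    rw [hxx]; exact hG.of_le (by exact_mod_cast le_top)
  have hc : ContinuousAt f.toFun x :=
    (Topology.IsInducing.subtypeVal.continuousAt_iff).2 hf.continuous.continuousAt
  refine (ContDiffAt.comp (φ x) hG'
    (hf.contDiffAt_comp_chart_symm hφ hx)).congr_of_eventuallyEq ?_
  filter_upwards [(hc.tendsto.comp (tendsto_chart_symm φ hx)).eventually hGψ] with y hy
    using hy.symm

/-- The strict inequalities hold at `η = 0` and persist near each `(0, x)`; compactness of `K` makes
the range of `η` uniform. The centre `f₀` may differ from the limit `f`, since the topology is
generated by these sets. -/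
theorem JetConverges.eventually_mem_subbasicNhd {m : ℕ} {K K' : Set U} {g : ℝ → U → Z}
    (hg : JetConverges m K' g) {f f₀ : SmoothMap U Z} (hfg : g 0 = f.toFun) {d e : ℕ}
    {φ : OpenPartialHomeomorph U (Fin d → ℝ)} {ψ : OpenPartialHomeomorph Z (Fin e → ℝ)}
    {r : ℕ} {ε : ℝ} (hφ : IsSmoothChart φ) (hψ : IsSmoothChart ψ) (hK : IsCompact K)
    (hKφ : K ⊆ φ.source) (hKψ : ∀ x ∈ K, f₀.toFun x ∈ ψ.source)
    (hf : f ∈ f₀.subbasicNhd φ ψ K r ε) (hrm : r ≤ m) (hKK' : K ⊆ K') :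
    ∀ᶠ η in 𝓝 0, ∀ G : SmoothMap U Z, G.toFun = g η → G ∈ f₀.subbasicNhd φ ψ K r ε := by
  have key : ∀ x ∈ K, ∀ᶠ p : ℝ × U in 𝓝 (0, x), g p.1 p.2 ∈ ψ.source ∧ ∀ k ≤ r,
      ‖iteratedFDeriv ℝ k (fun y => ψ (f₀.toFun (φ.symm y))) (φ p.2) -
        iteratedFDeriv ℝ k (fun y => ψ (g p.1 (φ.symm y))) (φ p.2)‖ < ε := by
    intro x hx
    have hxφ := hKφ hx
    have hxx := φ.left_inv hxφ
    have hfx := hf.1 x hx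
    have hu := hg x (hKK' hx) d φ hφ hxφ
    have hφc : Tendsto (fun p : ℝ × U => (p.1, φ p.2)) (𝓝 (0, x)) (𝓝 (0, φ x)) :=
      (continuousAt_fst.prodMk ((φ.continuousAt hxφ).comp_of_eq continuousAt_snd rfl)).tendsto
    have hlim : Tendsto (fun p : ℝ × (Fin d → ℝ) => g p.1 (φ.symm p.2)) (𝓝 (0, φ x))
        (𝓝 (f.toFun x)) := by
      refine tendsto_subtype_rng.2 ?_
      simpa [hxx, hfg] using hu.continuousAt.tendsto
    obtain ⟨F, hF, hFψ⟩ := hψ.1 _ hfx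
    have hF' : ContDiffAt ℝ m F (g 0 (φ.symm (φ x)) : κ → ℝ) := by
      rw [hxx, hfg]; exact hF.of_le (by exact_mod_cast le_top)
    have hjet : JetContinuousAt m (fun η y => ψ (g η (φ.symm y))) 0 (φ x) :=
      ((jetContinuousAt_const (T := ℝ) (τ := 0) hF').comp hu).congr (hlim.eventually hFψ)
    have hmem : ∀ᶠ p : ℝ × U in 𝓝 (0, x), g p.1 p.2 ∈ ψ.source := by
      have h1 := hφc.eventually (hlim.eventually (ψ.open_source.mem_nhds hfx))
      have h2 := (continuous_snd.tendsto ((0 : ℝ), x)).eventually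
        (φ.open_source.mem_nhds hxφ)
      filter_upwards [h1, h2] with p hp hp2
      rwa [φ.left_inv hp2] at hp
    refine hmem.and ?_
    have hfin : ∀ k ∈ Iic r, ∀ᶠ p : ℝ × U in 𝓝 (0, x),
        ‖iteratedFDeriv ℝ k (fun y => ψ (f₀.toFun (φ.symm y))) (φ p.2) -
        iteratedFDeriv ℝ k (fun y => ψ (g p.1 (φ.symm y))) (φ p.2)‖ < ε := by
      intro k hk
      have hk' : k ≤ r := hk
      have h1 := (hjet.2 k (hk'.trans hrm)).tendsto.comp hφc
      have h2 : Tendsto (fun p : ℝ × U =>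
          iteratedFDeriv ℝ k (fun y => ψ (f₀.toFun (φ.symm y))) (φ p.2)) (𝓝 (0, x))
          (𝓝 (iteratedFDeriv ℝ k (fun y => ψ (f₀.toFun (φ.symm y))) (φ x))) := by
        have h3 := (contDiffAt_chart_expression hφ hψ hxφ (hKψ x hx) k).continuousAt_iteratedFDeriv
          (k := k) le_rfl
        exact h3.tendsto.comp ((continuous_snd.tendsto _).comp hφc)
      refine (h2.sub h1).norm.eventually (eventually_lt_nhds ?_)
      simpa [hfg] using hf.2 x hx k hk'
    filter_upwards [(eventually_all_finite (finite_Iic r)).2 hfin] with p hp k hk using hp k hk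
  filter_upwards [hK.eventually_forall_of_forall_eventually
    (P := fun (η : ℝ) (x : U) => g η x ∈ ψ.source ∧ ∀ k ≤ r,
      ‖iteratedFDeriv ℝ k (fun y => ψ (f₀.toFun (φ.symm y))) (φ x) -
        iteratedFDeriv ℝ k (fun y => ψ (g η (φ.symm y))) (φ x)‖ < ε) key] with η hη G hG
  refine ⟨fun x hx => ?_, fun x hx => ?_⟩
  · rw [hG]; exact (hη x hx).1
  · rw [hG]; exact (hη x hx).2

/-- A basic neighbourhood is a finite intersection of subbasic ones, so one family, for a bound on
the orders and the union of the compact sets, serves them all. -/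
theorem exists_regularSection_mem_of_isApproximable {X : Set (ι → ℝ)} {h : Z → X}
    {f : SmoothMap U Z}
    (hf : ∀ (m : ℕ) (K : Set U), IsCompact K → IsApproximable h m K f.toFun)
    {𝒰 : Set (SmoothMap U Z)} (h𝒰 : 𝒰 ∈ 𝓝 f) : ∃ g ∈ 𝒰, IsRegularSection h g.toFun := by
  obtain ⟨_, ⟨𝒮, ⟨hfin, hsub⟩, rfl⟩, hf𝒮, h𝒮⟩ :=
    (TopologicalSpace.isTopologicalBasis_of_subbasis
      (rfl : SmoothMap.instTopologicalSpace (M := U) (N := Z) = _)).mem_nhds_iff.1 h𝒰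
  have key : ∀ s : 𝒮, ∃ (r : ℕ) (K : Set U), IsCompact K ∧ ∀ (m : ℕ) (K' : Set U)
      (g : ℝ → U → Z), JetConverges m K' g → g 0 = f.toFun → r ≤ m → K ⊆ K' →
      ∀ᶠ η in 𝓝 0, ∀ G : SmoothMap U Z, G.toFun = g η → G ∈ s.1 := by
    intro s
    obtain ⟨f₀, d, e, φ, ψ, K, r, ε, hφ, hψ, hK, hKφ, hKψ, -, hs⟩ := hsub s.2
    refine ⟨r, K, hK, fun m K' g hg hg0 hr hKK' => ?_⟩
    have hfs := hf𝒮 s.1 s.2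
    rw [hs] at hfs ⊢
    exact hg.eventually_mem_subbasicNhd hg0 hφ hψ hK hKφ hKψ hfs hr hKK'
  choose r K hK hrK using key
  have : Finite 𝒮 := hfin
  obtain ⟨m, hm⟩ := (finite_range r).bddAbove
  obtain ⟨g, hg0, hgr, hg⟩ := hf m (⋃ s, K s) (isCompact_iUnion hK)
  have hev : ∀ᶠ η in 𝓝 0, ∀ s : 𝒮, ∀ G : SmoothMap U Z, G.toFun = g η → G ∈ s.1 :=
    eventually_all.2 fun s => hrK s m _ g hg hg0 (hm (mem_range_self s)) (subset_iUnion K s)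
  obtain ⟨η, hη, hη0⟩ := ((hev.filter_mono nhdsWithin_le_nhds).and
    (eventually_mem_nhdsWithin (a := (0 : ℝ)) (s := {0}ᶜ))).exists
  refine ⟨⟨g η, (hgr η hη0).isSmooth⟩, h𝒮 fun s hs => hη ⟨s, hs⟩ _ rfl, hgr η hη0⟩

end WeakTopology

/-! ### Local corrections and propagation along the homotopy -/

section Fragmentation

variable {κ : Type} [Fintype κ] {Z : Set (κ → ℝ)}

theorem IsTrivialSpray.isSmoothOfOrder {ι : Type} [Fintype ι] {X U : Set (ι → ℝ)} {h : Z → X}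
    {r m : ℕ} {S : Z → (Fin r → ℝ) → Z} (hS : IsTrivialSpray h S) {c : U → Z}
    (hc : IsSmoothOfOrder m fun x => (c x : κ → ℝ)) {w : U → Fin r → ℝ}
    (hw : IsSmoothOfOrder m w) : IsSmoothOfOrder m fun x => (S (c x) (w x) : κ → ℝ) := by
  intro x
  obtain ⟨C, hC, hCc⟩ := hc x
  obtain ⟨W, hW, hWw⟩ := hw x
  obtain ⟨G, hG, hGS⟩ := hS.smooth (c x) (w x)
  have hG' : ContDiffAt ℝ m G (C x, W x) := by
    rw [hCc.self_of_nhds, hWw.self_of_nhds]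
    exact hG.of_le (by exact_mod_cast le_top)
  refine ⟨fun y => G (C y, W y), ContDiffAt.comp (x : ι → ℝ) hG' (hC.prodMk hW), ?_⟩
  have hcw : Tendsto (fun y => (c y, w y)) (𝓝 x) (𝓝 (c x, w x)) :=
    (tendsto_subtype_rng.2 hc.continuous.continuousAt.tendsto).prodMk_nhds
      hw.continuous.continuousAt.tendsto
  filter_upwards [hCc, hWw, hcw.eventually hGS] with y h1 h2 h3
  rw [h1, h2]
  exact h3

theorem IsTrivialSpray.continuous {ι : Type} {X : Set (ι → ℝ)} {h : Z → X}
    {r : ℕ} {S : Z → (Fin r → ℝ) → Z} (hS : IsTrivialSpray h S) :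
    Continuous fun p : Z × (Fin r → ℝ) => S p.1 p.2 := by
  refine continuous_iff_continuousAt.2 fun ⟨z, u⟩ => ?_
  obtain ⟨G, hG, hGS⟩ := hS.smooth z u
  rw [Topology.IsInducing.subtypeVal.continuousAt_iff]
  have hi : Continuous fun p : Z × (Fin r → ℝ) => ((p.1 : κ → ℝ), p.2) := by fun_prop
  exact (hG.continuousAt.comp_of_eq hi.continuousAt rfl).congr hGS

variable {a : ℕ} {X U : Set (Fin a → ℝ)} {h : Z → X} {T : Type} [TopologicalSpace T]

/-- The maps `c t` are `C^m` sections for `t` near `τ` and converge to `c τ = c₀` as `t → τ`. -/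
structure IsSectionFamily (h : Z → X) (m : ℕ) (τ : T) (c₀ : U → Z) (c : T → U → Z) : Prop where
  base : c τ = c₀
  continuousAt : ∀ x, ContinuousAt (fun p : T × U => c p.1 p.2) (τ, x)
  smooth : ∀ᶠ t in 𝓝 τ, IsSmoothOfOrder m fun x => (c t x : κ → ℝ)
  isSection : ∀ᶠ t in 𝓝 τ, IsSection h (c t)

/-- Every family `c` of sections can be changed into one that agrees with the family `d` near `A`,
without losing approximability or agreement with `d`. -/
def IsReplaceable (h : Z → X) (m : ℕ) (K : Set U) (τ : T) (d : T → U → Z) (A : Set U) : Prop :=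
  ∀ c, IsSectionFamily h m τ (d τ) c → ∃ c', IsSectionFamily h m τ (d τ) c' ∧
    (∀ᶠ t in 𝓝 τ, IsApproximable h m K (c t) → IsApproximable h m K (c' t)) ∧
    (∀ᶠ t in 𝓝 τ, ∀ x, c t x = d t x → c' t x = d t x) ∧
    ∀ᶠ t in 𝓝 τ, ∀ x ∈ A, ∀ᶠ y in 𝓝 x, c' t y = d t y

/-- Preservation of points where the family already equals `d` keeps the second correction from
spoiling the first. -/
theorem IsReplaceable.union {m : ℕ} {K : Set U} {τ : T} {d : T → U → Z} {A B : Set U}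
    (hA : IsReplaceable h m K τ d A) (hB : IsReplaceable h m K τ d B) :
    IsReplaceable h m K τ d (A ∪ B) := by
  intro c hc
  obtain ⟨c₁, hc₁, ha₁, hd₁, hA₁⟩ := hA c hc
  obtain ⟨c₂, hc₂, ha₂, hd₂, hB₂⟩ := hB c₁ hc₁
  refine ⟨c₂, hc₂, ?_, ?_, ?_⟩
  · filter_upwards [ha₁, ha₂] with t h1 h2 h using h2 (h1 h)
  · filter_upwards [hd₁, hd₂] with t h1 h2 x hx using h2 x (h1 x hx)
  · filter_upwards [hA₁, hB₂, hd₂] with t h1 h2 h3 x hx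
    rcases hx with hx | hx
    · filter_upwards [h1 x hx] with y hy using h3 y hy
    · exact h2 x hx

/-- The replacement is `S(c, χ θ(c, d))`. Where `χ = 1` it equals `d`, as `c` and `d` lie in the
same fibre; where `c = d` or `χ = 0` it equals `c`. -/
theorem exists_isReplaceable_nhds [LocallyCompactSpace U] (hreg : IsRegularMap h)
    (hmal : IsMalleable h) (hZ : ∀ z ∈ Z, IsNonsingularAt Z z) {m : ℕ} {K : Set U}
    (hK : IsCompact K) {τ : T} {d : T → U → Z} (hd : IsSectionFamily h m τ (d τ) d) (x₀ : U) :
    ∃ A ∈ 𝓝 x₀, IsReplaceable h m K τ d A := by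
  obtain ⟨r, S, θ, N, hS, hN, hx₀N, hθ, hθ0, hθS⟩ :=
    exists_trivialSpray_connecting hreg hmal (hZ (d τ x₀) (d τ x₀).2) m
  have hcont : ∀ x, ContinuousAt (d τ) x := fun x =>
    (hd.continuousAt x).comp_of_eq (f := fun x : U => (τ, x))
      (continuousAt_const.prodMk continuousAt_id) rfl
  have hV : {x : U | (d τ x : κ → ℝ) ∈ N} ∈ 𝓝 x₀ :=
    (continuous_subtype_val.continuousAt.comp (hcont x₀)).preimage_mem_nhds (hN.mem_nhds hx₀N)
  -- Compactness of `B` keeps the values of both families on `B` inside `N`, where `θ` is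
  -- controlled, for all `t` near `τ`.
  obtain ⟨B, hB, hBN, hBc⟩ := local_compact_nhds hV
  obtain ⟨δ, hδ, hδB⟩ : ∃ δ > 0, ∀ x : U, dist (x : Fin a → ℝ) x₀ < δ → x ∈ B := by
    obtain ⟨δ, hδ, hδB⟩ := Metric.mem_nhds_iff.1 hB
    exact ⟨δ, hδ, fun x hx => hδB hx⟩
  let χ : ContDiffBump (x₀ : Fin a → ℝ) := ⟨δ / 3, δ / 2, by positivity, by linarith⟩
  have hχB : ∀ x : U, (x : Fin a → ℝ) ∈ Metric.closedBall (x₀ : Fin a → ℝ) (δ / 2) → x ∈ B :=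
    fun x hx => hδB x ((Metric.mem_closedBall.1 hx).trans_lt (by linarith))
  have hχ0 : ∀ y : Fin a → ℝ, y ∉ Metric.closedBall (x₀ : Fin a → ℝ) (δ / 2) → χ y = 0 := by
    intro y hy
    rw [Metric.mem_closedBall, not_le] at hy
    exact χ.zero_of_le_dist hy.le
  have hopen : IsOpen (Metric.closedBall (x₀ : Fin a → ℝ) (δ / 2))ᶜ :=
    Metric.isClosed_closedBall.isOpen_compl
  refine ⟨{x : U | dist (x : Fin a → ℝ) x₀ < δ / 3}, ?_, fun c hc => ?_⟩
  · exact Metric.ball_mem_nhds x₀ (by positivity : 0 < δ / 3)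
  let w : T → U → Fin r → ℝ := fun t x => χ (x : Fin a → ℝ) • θ ((c t x : κ → ℝ), (d t x : κ → ℝ))
  have hmemN : ∀ e : T → U → Z, IsSectionFamily h m τ (d τ) e →
      ∀ᶠ t in 𝓝 τ, ∀ x ∈ B, (e t x : κ → ℝ) ∈ N := by
    intro e he
    refine hBc.eventually_forall_of_forall_eventually
      (P := fun (t : T) (x : U) => (e t x : κ → ℝ) ∈ N) fun x hx => ?_
    have h1 := continuous_subtype_val.continuousAt.comp (he.continuousAt x)
    refine h1.preimage_mem_nhds (hN.mem_nhds ?_)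
    simp only [Function.comp_apply, he.base]
    exact hBN hx
  have hwsmooth : ∀ᶠ t in 𝓝 τ, IsSmoothOfOrder m (w t) := by
    filter_upwards [hmemN c hc, hmemN d hd, hc.smooth, hd.smooth] with t hcN hdN hcs hds x
    by_cases hx : (x : Fin a → ℝ) ∈ Metric.closedBall (x₀ : Fin a → ℝ) (δ / 2)
    · obtain ⟨C, hC, hCc⟩ := hcs x
      obtain ⟨D, hD, hDd⟩ := hds x
      have hθ' : ContDiffAt ℝ m θ (C x, D x) := by
        rw [hCc.self_of_nhds, hDd.self_of_nhds]
        exact hθ _ (hcN x (hχB x hx)) _ (hdN x (hχB x hx))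
      refine ⟨fun y => χ y • θ (C y, D y),
        χ.contDiffAt.smul (ContDiffAt.comp (x : Fin a → ℝ) hθ' (hC.prodMk hD)), ?_⟩
      filter_upwards [hCc, hDd] with y h1 h2
      rw [h1, h2]
    · refine ⟨fun _ => 0, contDiffAt_const, ?_⟩
      filter_upwards [continuous_subtype_val.continuousAt.preimage_mem_nhds
        (hopen.mem_nhds hx)] with y hy
      simp [w, hχ0 y hy]
  have hwcont : ∀ x, ContinuousAt (fun p : T × U => w p.1 p.2) (τ, x) := by
    intro x
    by_cases hx : (x : Fin a → ℝ) ∈ Metric.closedBall (x₀ : Fin a → ℝ) (δ / 2)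
    · have hxN : (d τ x : κ → ℝ) ∈ N := hBN (hχB x hx)
      have h1 : ContinuousAt θ ((c τ x : κ → ℝ), (d τ x : κ → ℝ)) := by
        rw [hc.base]
        exact (hθ _ hxN _ hxN).continuousAt
      have h2 : ContinuousAt (fun p : T × U => χ (p.2 : Fin a → ℝ)) (τ, x) :=
        (χ.continuous.comp (continuous_subtype_val.comp continuous_snd)).continuousAt
      exact h2.smul (h1.comp_of_eq (f := fun p : T × U => ((c p.1 p.2 : κ → ℝ), (d p.1 p.2 : κ → ℝ)))
        ((continuous_subtype_val.continuousAt.comp (hc.continuousAt x)).prodMk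
          (continuous_subtype_val.continuousAt.comp (hd.continuousAt x))) rfl)
    · have h0 : ∀ᶠ p : T × U in 𝓝 (τ, x), (0 : Fin r → ℝ) = w p.1 p.2 := by
        have hc2 : Continuous fun p : T × U => (p.2 : Fin a → ℝ) :=
          continuous_subtype_val.comp continuous_snd
        filter_upwards [hc2.continuousAt.preimage_mem_nhds (hopen.mem_nhds hx)] with p hp
        simp [w, hχ0 _ hp]
      exact continuousAt_const.congr h0
  have hwd : ∀ t, (∀ x ∈ B, (d t x : κ → ℝ) ∈ N) → ∀ x, c t x = d t x → w t x = 0 := by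
    intro t ht x hx
    by_cases hxb : (x : Fin a → ℝ) ∈ Metric.closedBall (x₀ : Fin a → ℝ) (δ / 2)
    · simp [w, hx, hθ0 _ (ht x (hχB x hxb))]
    · simp [w, hχ0 _ hxb]
  refine ⟨fun t x => S (c t x) (w t x), ⟨?_, fun x => ?_, ?_, ?_⟩, ?_, ?_, ?_⟩
  · funext x
    have hτ : ∀ x ∈ B, (d τ x : κ → ℝ) ∈ N := fun x hx => hBN hx
    rw [hwd τ hτ x (congrFun hc.base x), hS.zero, hc.base]
  · exact hS.continuous.continuousAt.comp (f := fun p : T × U => (c p.1 p.2, w p.1 p.2))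
      ((hc.continuousAt x).prodMk (hwcont x))
  · filter_upwards [hc.smooth, hwsmooth] with t h1 h2 using hS.isSmoothOfOrder h1 h2
  · filter_upwards [hc.isSection] with t ht x
    rw [hS.fiber]
    exact ht x
  · filter_upwards [hwsmooth] with t ht happ using happ.spray hK hS ht
  · filter_upwards [hmemN d hd] with t ht x hx
    rw [hwd t ht x hx, hS.zero, hx]
  · filter_upwards [hmemN c hc, hmemN d hd, hc.isSection, hd.isSection] with t hcN hdN hcs hds x hx
    have hxo : {x : U | dist (x : Fin a → ℝ) x₀ < δ / 3} ∈ 𝓝 x :=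
      (Metric.isOpen_ball (x := x₀) (ε := δ / 3)).mem_nhds hx
    filter_upwards [hxo] with y hy
    have hyB : y ∈ B := hδB y (lt_trans hy (by linarith))
    have hχ1 : χ (y : Fin a → ℝ) = 1 :=
      χ.one_of_mem_closedBall (Metric.mem_closedBall.2 (le_of_lt hy))
    simp only [w, hχ1, one_smul]
    exact hθS _ _ (hcN y hyB) (hdN y hyB) (Subtype.ext ((hcs y).trans (hds y).symm))

theorem isReplaceable_of_isCompact [LocallyCompactSpace U] (hreg : IsRegularMap h)
    (hmal : IsMalleable h) (hZ : ∀ z ∈ Z, IsNonsingularAt Z z) {m : ℕ} {K : Set U}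
    (hK : IsCompact K) {τ : T} {d : T → U → Z} (hd : IsSectionFamily h m τ (d τ) d) :
    IsReplaceable h m K τ d K := by
  refine hK.induction_on (p := IsReplaceable h m K τ d) ?_ ?_ (fun A B hA hB => hA.union hB) fun x _ => ?_
  · exact fun c hc => ⟨c, hc, Eventually.of_forall fun _ h => h,
      Eventually.of_forall fun _ _ h => h, Eventually.of_forall fun _ x hx => absurd hx (by simp)⟩
  · intro A B hAB hB c hc
    obtain ⟨c', hc', ha, hd', hB'⟩ := hB c hc
    exact ⟨c', hc', ha, hd', hB'.mono fun t ht x hx => ht x (hAB hx)⟩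
  · obtain ⟨A, hA, hAr⟩ := exists_isReplaceable_nhds hreg hmal hZ hK hd x
    exact ⟨A, mem_nhdsWithin_of_mem_nhds hA, hAr⟩

/-- Approximability by regular sections propagates along homotopies through `C^∞` sections. -/
theorem HomotopicThroughSmoothSections.isApproximable [LocallyCompactSpace U]
    (hreg : IsRegularMap h) (hmal : IsMalleable h) (hZ : ∀ z ∈ Z, IsNonsingularAt Z z) {m : ℕ}
    {K : Set U} (hK : IsCompact K) {f₀ f₁ : U → Z} (hF : HomotopicThroughSmoothSections h f₀ f₁)
    (hf₁ : IsApproximable h m K f₁) : IsApproximable h m K f₀ := by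
  obtain ⟨F, hFc, hFs, hF0, hF1⟩ := hF
  let f : unitInterval → U → Z := fun t x => F (x, t)
  -- The parameter is a pair of times: `c` is the homotopy at the first, `d` at the second, and both
  -- have base `f t₀` on the diagonal. Fixing the second time at `t₀` gives closedness below, fixing
  -- the first gives openness.
  have hlocal : ∀ t₀ : unitInterval, ∀ᶠ p : unitInterval × unitInterval in 𝓝 (t₀, t₀),
      IsApproximable h m K (f p.1) → IsApproximable h m K (f p.2) := by
    intro t₀
    have hfam : ∀ σ : unitInterval × unitInterval → unitInterval, Continuous σ →
        σ (t₀, t₀) = t₀ → IsSectionFamily h m (t₀, t₀) (f t₀) fun p => f (σ p) := by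
      intro σ hσ h0
      refine ⟨by simp only [h0], fun x => ?_,
        Eventually.of_forall fun p => (hFs (σ p)).1.isSmoothOfOrder m,
        Eventually.of_forall fun p => (hFs (σ p)).2⟩
      have : Continuous fun q : (unitInterval × unitInterval) × U => F (q.2, σ q.1) := by fun_prop
      exact this.continuousAt
    obtain ⟨c', -, ha, -, hK'⟩ := isReplaceable_of_isCompact (τ := (t₀, t₀))
      (d := fun p => f p.2) hreg hmal hZ hK (hfam Prod.snd continuous_snd rfl) _ (hfam Prod.fst continuous_fst rfl)
    filter_upwards [ha, hK'] with p h1 h2 happ using (h1 happ).congr h2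
  have hclopen : IsClopen {t | IsApproximable h m K (f t)} := by
    constructor
    · rw [← isOpen_compl_iff, isOpen_iff_eventually]
      intro t₀ ht₀
      have hc : Continuous fun t : unitInterval => (t, t₀) := by fun_prop
      filter_upwards [(hc.tendsto t₀).eventually (hlocal t₀)] with t ht happ using ht₀ (ht happ)
    · rw [isOpen_iff_eventually]
      intro t₀ ht₀
      have hc : Continuous fun t : unitInterval => (t₀, t) := by fun_prop
      filter_upwards [(hc.tendsto t₀).eventually (hlocal t₀)] with t ht using ht ht₀
  have h1 : f 1 = f₁ := funext hF1
  have h0 : f 0 = f₀ := funext hF0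
  have huniv := hclopen.eq_univ ⟨1, show IsApproximable h m K (f 1) by rwa [h1]⟩
  have h0mem : IsApproximable h m K (f 0) := huniv.ge (mem_univ 0)
  rwa [h0] at h0mem

theorem IsAlgebraicSet.isClosed {ι : Type} {X : Set (ι → ℝ)} (hX : IsAlgebraicSet X) :
    IsClosed X := by
  obtain ⟨A, rfl⟩ := hX
  simp only [ofPred_forall]
  exact isClosed_iInter fun P => isClosed_iInter fun _ =>
    isClosed_eq (MvPolynomial.continuous_eval P) continuous_const

end Fragmentation

end RealAlg

theorem theorem3p9 {a b : ℕ} (X : Set (Fin a → ℝ)) (Z : Set (Fin b → ℝ))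
    (hX : RealAlg.IsNonsingularVariety X) (hZ : RealAlg.IsNonsingularVariety Z)
    (h : Z → X) (hreg : RealAlg.IsRegularMap h) (hsurj : Function.Surjective h)
    (hsub : RealAlg.IsSubmersive h) (hmal : RealAlg.IsMalleable h)
    (U : Set (Fin a → ℝ)) (hU : RealAlg.IsOpenIn U X)
    (f : RealAlg.SmoothMap U Z) (hf : RealAlg.IsSection h f.toFun)
    (hhom : ∃ g : U → Z, RealAlg.IsRegularSection h g ∧
      RealAlg.HomotopicThroughSmoothSections h f.toFun g) :
    ∀ 𝒰 ∈ nhds f, ∃ g ∈ 𝒰, RealAlg.IsRegularSection h g.toFun := by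
  obtain ⟨g, hg, hfg⟩ := hhom
  obtain ⟨O, hO, hUO⟩ := hU
  have hUl : IsLocallyClosed U := by
    rw [hUO]
    exact hX.1.isClosed.isLocallyClosed.inter hO.isLocallyClosed
  have : LocallyCompactSpace U := hUl.locallyCompactSpace
  intro 𝒰 h𝒰
  exact RealAlg.exists_regularSection_mem_of_isApproximable
    (fun m K hK => hfg.isApproximable hreg hmal hZ.2 hK hg.isApproximable) h𝒰
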